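/- Let $n\ge 3$ and let $S^{n-1}$ be the unit sphere in $\mathbb R^n$ with its $O(n)$-invariant probability measure $d_*v$. A function $f:S^{n-1}\to\mathbb C$ belongs to $C^\infty(S^{n-1})$ if $x\mapsto f(x/|x|)$ is $C^\infty$ on $\mathbb R^n\setminus\{0\}$, and to $C^\infty_{even}(S^{n-1})$ if moreover $f(-u)=f(u)$. For $\operatorname{Re}\mu>-1$, $\mu\notin\{0,2,4,\dots\}$, put $$(\mathscr C^{\mu}f)(u)=\frac{\pi^{1/2}\,\Gamma(-\mu/2)}{\Gamma(n/2)\,\Gamma((\mu+1)/2)}\int_{S^{n-1}}f(v)\,|u\cdot v|^{\mu}\,d_*v,\qquad u\in S^{n-1}.$$ For $\lambda\in\mathbb C$, an integer $\ell\ge 0$ and a smooth function $g$ on $S^{n-1}$, let $(E_{\lambda}g)(x)=|x|^{\lambda}g(x/|x|)$, $x\neq0$, and $$(\Delta_{\lambda,\ell}\,g)(u)=\Big(-\frac14\Big)^{\ell}\,(\Delta^{\ell}E_{\lambda+2\ell}\,g)(x)\Big|_{x=u},\qquad u\in S^{n-1},$$ where $\Delta$ is the Laplace operator on $\mathbb R^n$.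 Let $f\in C^\infty_{even}(S^{n-1})$. Then the integral above converges absolutely whenever $\operatorname{Re}\mu>-1$; for every $u\in S^{n-1}$ the function $\mu\mapsto(\mathscr C^{\mu}f)(u)$ has a meromorphic continuation to $\mathbb C$ that is analytic outside $\{0,2,4,\dots\}$, again denoted by $(\mathscr C^\mu f)(u)$; and $\mathscr C^\mu f\in C^\infty_{even}(S^{n-1})$ for every $\mu\in\mathbb C\setminus\{0,2,4,\dots\}$. Moreover, for every integer $\ell\ge0$ and every $\lambda\in\mathbb C$ with $\lambda+2\ell\notin\{0,2,4,\dots\}$, $$\Delta_{\lambda,\ell}\,\mathscr C^{\lambda+2\ell}f=\mathscr C^{\lambda}f\quad\text{on } S^{n-1}.$$ -/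

import Mathlib

open scoped ContDiff

noncomputable section

namespace CosineTransform

/-- The unit sphere `S^{n-1}` in `ℝⁿ`. -/
abbrev Sph (n : ℕ) : Type := Metric.sphere (0 : EuclideanSpace ℝ (Fin n)) 1

/-- The radial projection `x / |x|` of a nonzero vector. -/
def toSph {n : ℕ} (x : EuclideanSpace ℝ (Fin n)) (hx : x ≠ 0) : Sph n :=
  ⟨‖x‖⁻¹ • x, by
    rw [mem_sphere_zero_iff_norm, norm_smul, norm_inv, norm_norm,
      inv_mul_cancel₀ (norm_ne_zero_iff.mpr hx)]⟩

open Classical in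
/-- The `μ`-homogeneous extension `(E_μ f)(x) = |x|^μ f(x/|x|)`, `x ≠ 0`. The value `0` at the
origin is a placeholder. -/
def homExt {n : ℕ} (μ : ℂ) (f : Sph n → ℂ) (x : EuclideanSpace ℝ (Fin n)) : ℂ :=
  if hx : x ≠ 0 then ((‖x‖ : ℝ) : ℂ) ^ μ * f (toSph x hx) else 0

/-- `f ∈ C^∞(S^{n-1})`: the extension `x ↦ f(x/|x|)` is smooth on `ℝⁿ \ {0}`. -/
def IsSmooth {n : ℕ} (f : Sph n → ℂ) : Prop :=
  ContDiffOn ℝ ∞ (homExt 0 f) {0}ᶜ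

/-- `f ∈ C^∞_even(S^{n-1})`. -/
def IsSmoothEven {n : ℕ} (f : Sph n → ℂ) : Prop :=
  IsSmooth f ∧ ∀ u, f (-u) = f u

/-- The rotation invariant probability measure `d_*v` on the sphere: the surface measure divided
by its total mass. -/
def sphMeasure (n : ℕ) : MeasureTheory.Measure (Sph n) :=
  let σ := (MeasureTheory.volume : MeasureTheory.Measure (EuclideanSpace ℝ (Fin n))).toSphere
  (σ Set.univ)⁻¹ • σ

/-- The normalizing factor `γ(μ) = π^{1/2} Γ(-μ/2) / (Γ(n/2) Γ((μ+1)/2))`. -/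
def gam (n : ℕ) (μ : ℂ) : ℂ :=
  ((Real.sqrt Real.pi : ℝ) : ℂ) * Complex.Gamma (-μ / 2) /
    (Complex.Gamma ((n : ℂ) / 2) * Complex.Gamma ((μ + 1) / 2))

/-- The exceptional set `{0, 2, 4, …}`. -/
def poles : Set ℂ := {z | ∃ k : ℕ, z = 2 * (k : ℂ)}

/-- The integrand `v ↦ f(v) |u · v|^μ` of the cosine transform. -/
def cosineIntegrand {n : ℕ} (μ : ℂ) (f : Sph n → ℂ) (u v : Sph n) : ℂ :=
  f v * ((|inner ℝ (u : EuclideanSpace ℝ (Fin n)) (v : EuclideanSpace ℝ (Fin n))| : ℝ) : ℂ) ^ μ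

/-- The integral defining the normalized `μ`-cosine transform of `f` at `u`, for `Re μ > -1`. -/
def cosineIntegral {n : ℕ} (μ : ℂ) (f : Sph n → ℂ) (u : Sph n) : ℂ :=
  gam n μ * ∫ v, cosineIntegrand μ f u v ∂(sphMeasure n)

/-- `F` is the meromorphic continuation to `ℂ`, with no poles outside `{0, 2, 4, …}`, of the
function `μ ↦ cosineIntegral μ f u` given for `Re μ > -1`, `μ ≠ 0, 2, 4, …`. By the identity
theorem the values of `F` outside `{0, 2, 4, …}` are determined by this. -/
def IsContinuation {n : ℕ} (f : Sph n → ℂ) (u : Sph n) (F : ℂ → ℂ) : Prop :=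
  Meromorphic F ∧ AnalyticOnNhd ℂ F polesᶜ ∧
    ∀ μ : ℂ, -1 < μ.re → μ ∉ poles → F μ = cosineIntegral μ f u

/-- The normalized cosine transform `𝒞^μ f`, in the sense of meromorphic continuation in `μ`. It
is meaningful for `μ ∉ poles`, as soon as a continuation exists. -/
def cosineTransform {n : ℕ} (μ : ℂ) (f : Sph n → ℂ) (u : Sph n) : ℂ :=
  Classical.epsilon (IsContinuation f u) μ

/-- The weighted operator
`(Δ_{μ,ℓ} f)(u) = (-1/4)^ℓ (Δ^ℓ E_{μ+2ℓ} f)(x)` at `x = u`, with `Δ` the Laplacian of `ℝⁿ`. -/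
def weightedLaplacian {n : ℕ} (μ : ℂ) (l : ℕ) (f : Sph n → ℂ) (u : Sph n) : ℂ :=
  (-1 / 4 : ℂ) ^ l *
    ((Laplacian.laplacian :
      (EuclideanSpace ℝ (Fin n) → ℂ) → EuclideanSpace ℝ (Fin n) → ℂ)^[l]
        (homExt (μ + 2 * (l : ℂ)) f)) (u : EuclideanSpace ℝ (Fin n))

end CosineTransform

end

/-! For large `Re μ` the identity is a computation. If `|v| = 1`, the Laplacian in `x` of `|x·v|^μ`
is `μ(μ-1)|x·v|^(μ-2)`; the recursion of `Γ((μ+1)/2)` absorbs `μ-1`, that of `Γ(-μ/2)` absorbs `μ`,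
and a factor `-4` per Laplacian remains. The work lies in continuing this in `μ` while keeping
smoothness in `x`.

The sphere integral is first moved to `ℝⁿ`. By `polar_integral` it equals, up to a nonzero constant,
`∫ |⟪x, y⟫|^μ G(y) dy`, where `G = testFn f μ` is a radially cut off homogeneous extension of `f`.
For a fixed unit vector `e`, `integral_absPow_mul_reflQuot` integrates by parts and trades the
exponent `z` for `z + 2`. After division by `Γ((μ+1)/2)` the resulting formulas agree on overlaps
and glue to an entire function (`exists_entire_hyperplaneReg`).

For variable `x`, a linear change of variables (`integral_chart`) turns `⟪x, ·⟫` into `⟪e, ·⟫`, so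
that near a given point `x` enters only through a smooth test function. Differentiation under the
integral then gives smoothness in `x` and holomorphy in `μ` of the Laplacian, and the identity
theorem extends the computation to all `μ` (`laplacian_reg`). It replaces `G` by `|y|²G`, which is
`testFn f (μ - 2)`: the step from `μ` to `μ - 2` closes up and can be iterated. -/

noncomputable section

namespace CosineTransform

open MeasureTheory Set Filter Topology
open scoped Convolution

/-! ### Integrals depending smoothly on a parameter -/

section ParametricIntegrals

variable {P : Type*} [NormedAddCommGroup P] [NormedSpace ℝ P]
  {E : Type*} [NormedAddCommGroup E]

/-- A jointly `C^m` family of functions on `E`, with parameter in `s`, all supported in the ball of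
radius `R`. -/
structure SmoothFamily [NormedSpace ℝ E] (m : ℕ∞) (s : Set P) (R : ℝ) (g : P → E → ℂ) : Prop where
  smooth : ∀ p ∈ s, ∀ y, ContDiffAt ℝ m (Function.uncurry g) (p, y)
  zero : ∀ p ∈ s, ∀ y, R < ‖y‖ → g p y = 0

namespace SmoothFamily

variable [NormedSpace ℝ E] {m : ℕ∞} {s : Set P} {R : ℝ} {g : P → E → ℂ}

lemma of_le {k : ℕ∞} (hg : SmoothFamily m s R g) (h : k ≤ m) : SmoothFamily k s R g :=
  ⟨fun p hp y => (hg.smooth p hp y).of_le (by exact_mod_cast h), hg.zero⟩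

lemma contDiff_right (hg : SmoothFamily m s R g) {p : P} (hp : p ∈ s) : ContDiff ℝ m (g p) := by
  rw [contDiff_iff_contDiffAt]
  intro y
  exact (hg.smooth p hp y).comp y (contDiffAt_const.prodMk contDiffAt_id)

lemma contDiffAt_left (hg : SmoothFamily m s R g) {p : P} (hp : p ∈ s) (y : E) :
    ContDiffAt ℝ m (fun q => g q y) p :=
  (hg.smooth p hp y).comp p (contDiffAt_id.prodMk contDiffAt_const)

lemma hasCompactSupport [ProperSpace E] (hg : SmoothFamily m s R g) {p : P} (hp : p ∈ s) :
    HasCompactSupport (g p) :=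
  HasCompactSupport.intro (isCompact_closedBall (0 : E) R) fun y hy =>
    hg.zero p hp y (by simpa using hy)

lemma integrable [MeasurableSpace E] [BorelSpace E] [ProperSpace E] {ν : Measure E}
    (hg : SmoothFamily m s R g) {p : P} (hp : p ∈ s) {f : E → ℂ} (hf : LocallyIntegrable f ν) :
    Integrable (fun y => f y * g p y) ν := by
  have := hf.integrable_smul_right_of_hasCompactSupport (hg.contDiff_right hp).continuous
    (hg.hasCompactSupport hp)
  simpa using this

lemma fderiv_left (hg : SmoothFamily m s R g) (hs : IsOpen s) {k : ℕ∞} (hk : k + 1 ≤ m) (v : P) :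
    SmoothFamily k s R (fun p y => fderiv ℝ (fun q => g q y) p v) := by
  refine ⟨fun p hp y => ?_, fun p hp y hy => ?_⟩
  · have h : ContDiffAt ℝ m (Function.uncurry fun (z : P × E) (q : P) => g q z.2) ((p, y), p) := by
      have := hg.smooth p hp y
      exact this.comp (f := fun w : (P × E) × P => (w.2, w.1.2)) ((p, y), p)
        (contDiffAt_snd.prodMk (contDiffAt_snd.comp _ contDiffAt_fst))
    have := ContDiffAt.fderiv (g := fun z : P × E => z.1) (m := k) (n := m) h contDiffAt_fst
      (by exact_mod_cast hk)
    exact this.clm_apply contDiffAt_const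
  · have : (fun q => g q y) =ᶠ[𝓝 p] fun _ => 0 := by
      filter_upwards [hs.mem_nhds hp] with q hq using hg.zero q hq y hy
    simp [this.fderiv_eq]

lemma fderiv_right (hg : SmoothFamily m s R g) {k : ℕ∞} (hk : k + 1 ≤ m) (e : E) :
    SmoothFamily k s R (fun p y => fderiv ℝ (g p) y e) := by
  refine ⟨fun p hp y => ?_, fun p hp y hy => ?_⟩
  · have h : ContDiffAt ℝ m (Function.uncurry fun (z : P × E) (w : E) => g z.1 w) ((p, y), y) := by
      have := hg.smooth p hp y
      exact this.comp (f := fun w : (P × E) × E => (w.1.1, w.2)) ((p, y), y)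
        ((contDiffAt_fst.comp _ contDiffAt_fst).prodMk contDiffAt_snd)
    have := ContDiffAt.fderiv (g := fun z : P × E => z.2) (m := k) (n := m) h contDiffAt_snd
      (by exact_mod_cast hk)
    exact this.clm_apply contDiffAt_const
  · have : g p =ᶠ[𝓝 y] fun _ => 0 := by
      filter_upwards [(isOpen_lt continuous_const continuous_norm).mem_nhds hy] with z hz
        using hg.zero p hp z hz
    simp [this.fderiv_eq]

lemma contDiffOn_comp_neg (hg : SmoothFamily m s R g) :
    ContDiffOn ℝ m (Function.uncurry fun p y => g p (-y)) (s ×ˢ univ) := by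
  rintro ⟨p, y⟩ ⟨hp, -⟩
  exact ((hg.smooth p hp (-y)).comp (f := fun z : P × E => (z.1, -z.2)) (p, y)
    (contDiffAt_fst.prodMk contDiffAt_snd.neg)).contDiffWithinAt

end SmoothFamily

variable [NormedSpace ℝ E] [ProperSpace E] [MeasurableSpace E] [BorelSpace E] {ν : Measure E}
  {m : ℕ∞} {s : Set P} {R : ℝ} {g : P → E → ℂ} {f : E → ℂ}

/-- The integral is the value at `0` of the convolution of `f` with the reflected family `y ↦ g p
(-y)`, so smoothness of convolutions with a parameter applies. -/
lemma SmoothFamily.contDiffOn_integral (hg : SmoothFamily m s R g) (hs : IsOpen s)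
    (hf : LocallyIntegrable f ν) :
    ContDiffOn ℝ m (fun p => ∫ y, f y * g p y ∂ν) s := by
  have h := contDiffOn_convolution_right_with_param_comp (μ := ν) (ContinuousLinearMap.mul ℝ ℂ)
    (v := fun _ : P => (0 : E)) (n := m) contDiffOn_const hs (isCompact_closedBall (0 : E) R)
    (g := fun p y => g p (-y)) (fun p x hp hx => hg.zero p hp _ (by simpa using hx)) hf
    hg.contDiffOn_comp_neg
  simpa [convolution] using h

lemma SmoothFamily.fderiv_integral (hg : SmoothFamily m s R g) (hm : 1 ≤ m) (hs : IsOpen s)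
    (hf : LocallyIntegrable f ν) {p : P} (hp : p ∈ s) (v : P) :
    fderiv ℝ (fun p => ∫ y, f y * g p y ∂ν) p v =
      ∫ y, f y * fderiv ℝ (fun q => g q y) p v ∂ν := by
  have hg1 := hg.of_le hm
  have h := hasFDerivAt_convolution_right_with_param (μ := ν) (ContinuousLinearMap.mul ℝ ℂ)
    hs (isCompact_closedBall (0 : E) R)
    (g := fun p y => g p (-y)) (fun p x hp hx => hg.zero p hp _ (by simpa using hx)) hf
    hg1.contDiffOn_comp_neg (p, 0) hp
  have h2 := HasFDerivAt.comp (f := fun q : P => (q, (0 : E))) p h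
    ((hasFDerivAt_id p).prodMk (hasFDerivAt_const (0 : E) p))
  have h3 := h2.congr_of_eventuallyEq (f₁ := fun p => ∫ y, f y * g p y ∂ν)
    (Eventually.of_forall fun q => by simp [convolution])
  rw [h3.fderiv]
  have hd : ∀ y, DifferentiableAt ℝ (Function.uncurry fun p y => g p (-y)) (p, y) := fun y =>
    ((hg1.contDiffOn_comp_neg).contDiffAt ((hs.prod isOpen_univ).mem_nhds
      ⟨hp, mem_univ _⟩)).differentiableAt (by simp)
  have hcont : Continuous fun y : E =>
      fderiv ℝ (Function.uncurry fun p y => g p (-y)) (p, y) := by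
    have := hg1.contDiffOn_comp_neg.continuousOn_fderiv_of_isOpen (hs.prod isOpen_univ) (by simp)
    exact this.comp_continuous (by fun_prop) fun y => ⟨hp, mem_univ _⟩
  have hsupp : HasCompactSupport fun y : E =>
      fderiv ℝ (Function.uncurry fun p y => g p (-y)) (p, y) := by
    refine HasCompactSupport.intro (isCompact_closedBall (0 : E) R) fun y hy => ?_
    have hy' : R < ‖y‖ := by simpa using hy
    have : (Function.uncurry fun p y => g p (-y)) =ᶠ[𝓝 (p, y)] fun _ => 0 := by
      have h1 : s ×ˢ {z : E | R < ‖z‖} ∈ 𝓝 (p, y) :=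
        (hs.prod (isOpen_lt continuous_const continuous_norm)).mem_nhds ⟨hp, hy'⟩
      filter_upwards [h1] with z hz using hg.zero z.1 hz.1 _ (by simpa using hz.2)
    simp [this.fderiv_eq]
  -- The derivative of the convolution is taken jointly in parameter and point; evaluating it on
  -- `(v, 0)` keeps only the parameter direction.
  have h4 := convolution_precompR_apply (μ := ν) (ContinuousLinearMap.mul ℝ ℂ) hf hsupp hcont
    (0 : E) ((v, 0) : P × E)
  have e1 : ((f ⋆[(ContinuousLinearMap.mul ℝ ℂ).precompR (P × E), ν] fun x : E =>
      fderiv ℝ (Function.uncurry fun p y => g p (-y)) (p, x)) 0) (v, 0) =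
      ∫ y, f y * fderiv ℝ (fun q => g q y) p v ∂ν := by
    rw [h4]
    simp only [convolution, zero_sub, ContinuousLinearMap.mul_apply']
    congr 1 with y
    congr 1
    have h5 := HasFDerivAt.comp (f := fun q : P => (q, (-y : E))) p (hd (-y)).hasFDerivAt
      ((hasFDerivAt_id p).prodMk (hasFDerivAt_const (-y : E) p))
    have h6 : (Function.uncurry (fun p y => g p (-y)) ∘ fun q => (q, -y)) =
        fun q => g q y := by
      ext q; simp
    rw [h6] at h5
    rw [h5.fderiv]
    simp
  rw [← e1]
  simp
  rfl

end ParametricIntegrals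

/-! ### The Laplacian under the integral sign -/

section Laplacian

variable {V : Type*} [NormedAddCommGroup V] [InnerProductSpace ℝ V]

lemma iteratedFDeriv_two_diag {h : V → ℂ} {x : V} (hh : ContDiffAt ℝ 2 h x) (v : V) :
    iteratedFDeriv ℝ 2 h x ![v, v] = fderiv ℝ (fun z => fderiv ℝ h z v) x v := by
  rw [iteratedFDeriv_two_apply]
  have hd : DifferentiableAt ℝ (fderiv ℝ h) x :=
    (hh.fderiv_right (m := 1) (by norm_num)).differentiableAt (by simp)
  rw [fderiv_clm_apply hd (differentiableAt_const v)]
  simp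

variable [FiniteDimensional ℝ V]

lemma laplacian_eq_sum_fderiv {h : V → ℂ} {x : V} (hh : ContDiffAt ℝ 2 h x) :
    Laplacian.laplacian h x = ∑ i, fderiv ℝ (fun z => fderiv ℝ h z (stdOrthonormalBasis ℝ V i)) x
      (stdOrthonormalBasis ℝ V i) := by
  rw [InnerProductSpace.laplacian_eq_iteratedFDeriv_stdOrthonormalBasis]
  exact Finset.sum_congr rfl fun i _ => iteratedFDeriv_two_diag hh _

variable {E : Type*} [NormedAddCommGroup E] [NormedSpace ℝ E] {m : ℕ∞} {s : Set V}
  {R : ℝ} {g : V → E → ℂ}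

lemma SmoothFamily.laplacian_integrand (hg : SmoothFamily m s R g) (hm : 2 ≤ m) (hs : IsOpen s) :
    SmoothFamily 0 s R (fun p y => Laplacian.laplacian (fun q => g q y) p) := by
  have h1 : ∀ i, SmoothFamily 0 s R (fun p y => fderiv ℝ (fun z => fderiv ℝ (fun q => g q y) z
      (stdOrthonormalBasis ℝ V i)) p (stdOrthonormalBasis ℝ V i)) := fun i =>
    ((hg.of_le hm).fderiv_left hs (k := 1) (by norm_num) _).fderiv_left hs (by norm_num) _
  refine ⟨fun p hp y => ?_, fun p hp y hy => ?_⟩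
  · have : (Function.uncurry fun p y => Laplacian.laplacian (fun q => g q y) p) =ᶠ[𝓝 (p, y)]
        fun z => ∑ i, (Function.uncurry fun p y => fderiv ℝ (fun z => fderiv ℝ (fun q => g q y) z
      (stdOrthonormalBasis ℝ V i)) p (stdOrthonormalBasis ℝ V i)) z := by
      filter_upwards [(hs.prod isOpen_univ).mem_nhds ⟨hp, mem_univ y⟩] with z hz
      exact laplacian_eq_sum_fderiv (((hg.of_le hm).contDiffAt_left hz.1 z.2))
    exact (ContDiffAt.sum fun i _ => (h1 i).smooth p hp y).congr_of_eventuallyEq this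
  · rw [laplacian_eq_sum_fderiv ((hg.of_le hm).contDiffAt_left hp y)]
    exact Finset.sum_eq_zero fun i _ => (h1 i).zero p hp y hy

variable [ProperSpace E] [MeasurableSpace E] [BorelSpace E] {ν : Measure E} {f : E → ℂ}

lemma SmoothFamily.laplacian_integral (hg : SmoothFamily m s R g) (hm : 2 ≤ m) (hs : IsOpen s)
    (hf : LocallyIntegrable f ν) {p : V} (hp : p ∈ s) :
    Laplacian.laplacian (fun p => ∫ y, f y * g p y ∂ν) p =
      ∫ y, f y * Laplacian.laplacian (fun q => g q y) p ∂ν := by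
  have hg2 := hg.of_le hm
  have h0 : ContDiffAt ℝ 2 (fun p => ∫ y, f y * g p y ∂ν) p := by
    exact_mod_cast (hg2.contDiffOn_integral hs hf).contDiffAt (hs.mem_nhds hp)
  rw [laplacian_eq_sum_fderiv h0]
  have h1 : ∀ v, SmoothFamily 1 s R (fun p y => fderiv ℝ (fun q => g q y) p v) := fun v =>
    hg2.fderiv_left hs (by norm_num) _
  have h2 : ∀ v, SmoothFamily 0 s R (fun p y => fderiv ℝ (fun z => fderiv ℝ (fun q => g q y) z
      v) p v) := fun v => (h1 v).fderiv_left hs (by norm_num) _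
  have h3 : ∀ y, f y * Laplacian.laplacian (fun q => g q y) p =
      ∑ i, f y * fderiv ℝ (fun z => fderiv ℝ (fun q => g q y) z
      (stdOrthonormalBasis ℝ V i)) p (stdOrthonormalBasis ℝ V i) := by
    intro y
    rw [laplacian_eq_sum_fderiv (hg2.contDiffAt_left hp y), Finset.mul_sum]
  simp_rw [h3]
  rw [integral_finsetSum _ fun i _ => (h2 _).integrable hp hf]
  refine Finset.sum_congr rfl fun i _ => ?_
  set v := stdOrthonormalBasis ℝ V i
  rw [← (h1 v).fderiv_integral le_rfl hs hf hp]
  have : (fun z => fderiv ℝ (fun p => ∫ y, f y * g p y ∂ν) z v) =ᶠ[𝓝 p]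
      fun z => ∫ y, f y * fderiv ℝ (fun q => g q y) z v ∂ν := by
    filter_upwards [hs.mem_nhds hp] with z hz
    exact hg2.fderiv_integral (by norm_num) hs hf hz v
  rw [this.fderiv_eq]

end Laplacian

/-! ### The function `|t|^z` on the real line -/

section AbsPow

/-- The function `|t|^z` of a real variable `t`, with complex exponent. -/
def absPow (z : ℂ) (t : ℝ) : ℂ := ((|t| : ℝ) : ℂ) ^ z

@[simp] lemma absPow_neg (z : ℂ) (t : ℝ) : absPow z (-t) = absPow z t := by simp [absPow]

lemma absPow_mul (z : ℂ) (a b : ℝ) : absPow z (a * b) = absPow z a * absPow z b := by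
  simp only [absPow, abs_mul, Complex.ofReal_mul]
  exact Complex.mul_cpow_ofReal_nonneg (abs_nonneg a) (abs_nonneg b) z

lemma absPow_of_ne_zero (z : ℂ) {t : ℝ} (ht : t ≠ 0) :
    absPow z t = Complex.exp (Real.log t * z) := by
  have h : ((|t| : ℝ) : ℂ) ≠ 0 := by simpa using ht
  rw [absPow, Complex.cpow_def_of_ne_zero h, ← Complex.ofReal_log (abs_nonneg t), Real.log_abs]

lemma absPow_add (z w : ℂ) {t : ℝ} (ht : t ≠ 0) : absPow (z + w) t = absPow z t * absPow w t := by
  simp only [absPow_of_ne_zero _ ht, mul_add, Complex.exp_add]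

lemma norm_absPow (z : ℂ) {t : ℝ} (ht : t ≠ 0) : ‖absPow z t‖ = |t| ^ z.re := by
  rw [absPow, Complex.norm_cpow_eq_rpow_re_of_pos (abs_pos.mpr ht)]

lemma absPow_two (t : ℝ) : absPow 2 t = (t : ℂ) * t := by
  have : absPow 2 t = ((|t| : ℝ) : ℂ) ^ (2 : ℕ) := by
    rw [absPow, ← Complex.cpow_natCast]
    norm_num
  rw [this, ← Complex.ofReal_pow, sq_abs]
  push_cast
  ring

lemma absPow_add_two (z : ℂ) {t : ℝ} (ht : t ≠ 0) :
    absPow (z + 2) t = absPow z t * ((t : ℂ) * t) := by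
  rw [absPow_add _ _ ht, absPow_two]

lemma absPow_zero_right {z : ℂ} (hz : z ≠ 0) : absPow z 0 = 0 := by
  simp [absPow, Complex.zero_cpow hz]

lemma measurable_absPow (z : ℂ) : Measurable (absPow z) := by
  unfold absPow
  fun_prop

lemma continuous_absPow {z : ℂ} (hz : 0 < z.re) : Continuous (absPow z) :=
  (Complex.continuous_ofReal_cpow_const hz).comp continuous_abs

lemma hasDerivAt_absPow_of_ne_zero (z : ℂ) {t : ℝ} (ht : t ≠ 0) :
    HasDerivAt (absPow z) (z / t * absPow z t) t := by
  have h1 : HasDerivAt (fun s : ℝ => Complex.exp (Real.log s * z))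
      (Complex.exp (Real.log t * z) * (((t⁻¹ : ℝ) : ℂ) * z)) t :=
    (((Real.hasDerivAt_log ht).ofReal_comp).mul_const z).cexp
  have h2 : absPow z =ᶠ[𝓝 t] fun s : ℝ => Complex.exp (Real.log s * z) := by
    filter_upwards [isOpen_ne.mem_nhds ht] with s hs using absPow_of_ne_zero z hs
  refine (h1.congr_of_eventuallyEq h2).congr_deriv ?_
  rw [absPow_of_ne_zero z ht]
  push_cast
  ring

/-- At the origin the difference quotient is `|s|^z` itself, which tends to `0` because `Re z > 0`;
elsewhere this is the product rule. -/
lemma hasDerivAt_mul_absPow {z : ℂ} (hz : 0 < z.re) (t : ℝ) :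
    HasDerivAt (fun s : ℝ => (s : ℂ) * absPow z s) ((z + 1) * absPow z t) t := by
  rcases eq_or_ne t 0 with rfl | ht
  · have hz0 : z ≠ 0 := by rintro rfl; simp at hz
    rw [absPow_zero_right hz0, mul_zero, hasDerivAt_iff_tendsto_slope]
    have h := ((continuous_absPow hz).tendsto 0).mono_left (nhdsWithin_le_nhds (s := {0}ᶜ))
    rw [absPow_zero_right hz0] at h
    refine h.congr' ?_
    filter_upwards [self_mem_nhdsWithin] with s hs
    have hs' : (s : ℂ) ≠ 0 := by simpa using hs
    simp [slope, absPow_zero_right hz0]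
    field_simp
  · have h := (Complex.ofRealCLM.hasDerivAt (x := t)).mul (hasDerivAt_absPow_of_ne_zero z ht)
    refine (h.congr_deriv ?_)
    have ht' : (t : ℂ) ≠ 0 := by simpa using ht
    simp
    field_simp
    ring

lemma hasDerivAt_absPow {z : ℂ} (hz : 2 < z.re) (t : ℝ) :
    HasDerivAt (absPow z) (z * (t * absPow (z - 2) t)) t := by
  have hz2 : 0 < (z - 2).re := by simpa using hz
  have h := (Complex.ofRealCLM.hasDerivAt (x := t)).mul (hasDerivAt_mul_absPow hz2 t)
  have heq : absPow z = fun s : ℝ => (s : ℂ) * (s * absPow (z - 2) s) := by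
    ext s
    rcases eq_or_ne s 0 with rfl | hs
    · have : z ≠ 0 := by rintro rfl; simp at hz; linarith
      simp [absPow_zero_right this]
    · rw [show z = z - 2 + 2 by ring, absPow_add_two _ hs]
      simp only [add_sub_cancel_right]
      ring
  rw [heq]
  refine h.congr_deriv ?_
  simp
  ring

lemma deriv_absPow {z : ℂ} (hz : 2 < z.re) :
    deriv (absPow z) = fun t : ℝ => z * (t * absPow (z - 2) t) :=
  funext fun t => (hasDerivAt_absPow hz t).deriv

lemma deriv_deriv_absPow {z : ℂ} (hz : 2 < z.re) :
    deriv (deriv (absPow z)) = fun t : ℝ => z * ((z - 1) * absPow (z - 2) t) := by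
  rw [deriv_absPow hz]
  ext t
  rw [((hasDerivAt_mul_absPow (z := z - 2) (by simpa using hz) t).const_mul z).deriv]
  ring

lemma contDiff_absPow {z : ℂ} (hz : 2 < z.re) : ContDiff ℝ 2 (absPow z) := by
  have hz2 : 0 < (z - 2).re := by simpa using hz
  have h0 : ContDiff ℝ 0 (deriv (deriv (absPow z))) := by
    rw [contDiff_zero, deriv_deriv_absPow hz]
    exact continuous_const.mul (continuous_const.mul (continuous_absPow hz2))
  have h1 : ContDiff ℝ (0 + 1) (deriv (absPow z)) := by
    rw [contDiff_succ_iff_deriv]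
    refine ⟨?_, by simp, h0⟩
    rw [deriv_absPow hz]
    exact fun t => ((hasDerivAt_mul_absPow hz2 t).const_mul z).differentiableAt
  have h2 : ContDiff ℝ (1 + 1) (absPow z) := by
    rw [contDiff_succ_iff_deriv]
    exact ⟨fun t => (hasDerivAt_absPow hz t).differentiableAt, by simp, by simpa using h1⟩
  simpa [one_add_one_eq_two] using h2

lemma intervalIntegrable_absPow {z : ℂ} (hz : -1 < z.re) (a b : ℝ) :
    IntervalIntegrable (absPow z) volume a b := by
  have h : ∀ R : ℝ, 0 ≤ R → IntervalIntegrable (absPow z) volume 0 R := fun R hR => by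
    refine (intervalIntegral.intervalIntegrable_cpow' hz).congr fun x hx => ?_
    rw [uIoc_of_le hR] at hx
    simp [absPow, abs_of_pos hx.1]
  have h' : ∀ R : ℝ, IntervalIntegrable (absPow z) volume 0 R := fun R => by
    rcases le_total 0 R with hR | hR
    · exact h R hR
    · exact (IntervalIntegrable.iff_comp_neg (by simp)).2 (by simpa using h (-R) (by linarith))
  exact (h' a).symm.trans (h' b)

end AbsPow

/-! ### Powers of a linear form: local integrability and holomorphy in the exponent -/

section LinearForm

variable {E : Type*} [NormedAddCommGroup E] [InnerProductSpace ℝ E] [FiniteDimensional ℝ E]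
  [MeasurableSpace E] [BorelSpace E]

lemma ae_inner_ne_zero {e : E} (he : e ≠ 0) : ∀ᵐ y : E, inner ℝ e y ≠ 0 := by
  have h : (LinearMap.ker (innerSL ℝ e : E →ₗ[ℝ] ℝ)) ≠ ⊤ := by
    intro h
    have : e ∈ LinearMap.ker (innerSL ℝ e : E →ₗ[ℝ] ℝ) := h ▸ Submodule.mem_top
    simp [he] at this
  have h2 := Measure.addHaar_submodule (volume : Measure E) _ h
  rw [ae_iff]
  refine measure_mono_null (fun y hy => ?_) h2
  simpa using hy

/-- In an orthonormal basis containing `e`, a compact set lies in a cube, on which the function is a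
product of functions of one coordinate: `|t|^z` in the direction `e` and `1` in the others. -/
lemma locallyIntegrable_absPow_inner {e : E} (he : ‖e‖ = 1) {z : ℂ} (hz : -1 < z.re) :
    LocallyIntegrable fun y : E => absPow z (inner ℝ e y) := by
  have he0 : e ≠ 0 := by rintro rfl; simp at he
  have : Nontrivial E := ⟨e, 0, he0⟩
  let i₀ : Fin (Module.finrank ℝ E) := ⟨0, Module.finrank_pos⟩
  obtain ⟨b, hb⟩ := Orthonormal.exists_orthonormalBasis_extension_of_card_eq (𝕜 := ℝ) (E := E)
    (ι := Fin (Module.finrank ℝ E)) (by simp) (v := fun _ => e) (s := {i₀}) (by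
      rw [orthonormal_iff_ite]
      rintro ⟨i, rfl⟩ ⟨j, rfl⟩
      simp [he])
  have hb0 : b i₀ = e := hb i₀ rfl
  rw [locallyIntegrable_iff]
  intro K hK
  obtain ⟨R, hR0, hR⟩ := hK.isBounded.subset_closedBall_lt 0 0
  let F : (i : Fin (Module.finrank ℝ E)) → ℝ → ℂ := fun i =>
    (Icc (-R) R).indicator (if i = i₀ then absPow z else fun _ => 1)
  have hF : ∀ i, Integrable (F i) volume := by
    intro i
    rw [integrable_indicator_iff measurableSet_Icc]
    split_ifs
    · rw [integrableOn_Icc_iff_integrableOn_Ioc,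
        ← intervalIntegrable_iff_integrableOn_Ioc_of_le (by linarith)]
      exact intervalIntegrable_absPow hz _ _
    · exact continuous_const.integrableOn_Icc
  have hprod := Integrable.fintype_prod hF
  have hmp := (EuclideanSpace.volume_preserving_symm_measurableEquiv_toLp
    (Fin (Module.finrank ℝ E))).comp b.measurePreserving_repr
  have hint := hmp.integrable_comp_of_integrable hprod
  refine (hint.integrableOn (s := K)).congr_fun (fun y hy => ?_) hK.measurableSet
  have hy' : ∀ i, b.repr y i ∈ Icc (-R) R := by
    intro i
    have h1 : ‖y‖ ≤ R := by simpa using hR hy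
    have h2 : ‖b.repr y i‖ ≤ ‖b.repr y‖ := PiLp.norm_apply_le _ i
    rw [LinearIsometryEquiv.norm_map, Real.norm_eq_abs] at h2
    exact abs_le.mp (h2.trans h1)
  have : ∀ i, F i (b.repr y i) = if i = i₀ then absPow z (inner ℝ e y) else 1 := by
    intro i
    simp only [F]
    rw [indicator_of_mem (hy' i)]
    split_ifs with h
    · rw [h, b.repr_apply_apply, hb0]
    · rfl
  simp [Function.comp_def]
  simp [this]

lemma hasDerivAt_absPow_exponent (z : ℂ) {t : ℝ} (ht : t ≠ 0) :
    HasDerivAt (fun w => absPow w t) (Real.log t * absPow z t) z := by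
  have : (fun w => absPow w t) = fun w => Complex.exp (Real.log t * w) :=
    funext fun w => absPow_of_ne_zero w ht
  rw [this, absPow_of_ne_zero z ht]
  have h := ((hasDerivAt_id z).const_mul (Real.log t : ℂ)).cexp
  simpa [mul_comm] using h

/-- The logarithm costs a factor `|t|^(±ε)/ε`, and the margin `ε` keeps the shifted exponents in
`[a, b]`. This bound, uniform in `z`, is the majorant for differentiating in the exponent. -/
lemma norm_log_mul_absPow_le {a b ε : ℝ} (hε : 0 < ε) {z : ℂ} (ha : a + ε ≤ z.re)
    (hb : z.re + ε ≤ b) {t : ℝ} (ht : t ≠ 0) :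
    ‖(Real.log t : ℂ) * absPow z t‖ ≤ 2 / ε * (|t| ^ a + |t| ^ b) := by
  have ht0 : 0 < |t| := abs_pos.mpr ht
  have hmono : ∀ σ : ℝ, a ≤ σ → σ ≤ b → |t| ^ σ ≤ |t| ^ a + |t| ^ b := by
    intro σ h1 h2
    have pa := Real.rpow_nonneg ht0.le a
    have pb := Real.rpow_nonneg ht0.le b
    rcases le_total |t| 1 with h | h
    · linarith [Real.rpow_le_rpow_of_exponent_ge ht0 h h1]
    · linarith [Real.rpow_le_rpow_of_exponent_le h h2]
  have hlog : |Real.log t| ≤ (|t| ^ ε + |t| ^ (-ε)) / ε := by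
    have h1 := Real.log_le_rpow_div ht0.le hε
    have h2 := Real.log_le_rpow_div (inv_nonneg.mpr ht0.le) hε
    rw [Real.log_inv, Real.inv_rpow ht0.le, ← Real.rpow_neg ht0.le] at h2
    rw [← Real.log_abs t, add_div]
    have p1 : 0 ≤ |t| ^ ε / ε := by positivity
    have p2 : 0 ≤ |t| ^ (-ε) / ε := by positivity
    exact abs_le.mpr ⟨by linarith, by linarith⟩
  rw [norm_mul, norm_absPow z ht, Complex.norm_real, Real.norm_eq_abs]
  calc |Real.log t| * |t| ^ z.re ≤ (|t| ^ ε + |t| ^ (-ε)) / ε * |t| ^ z.re := by gcongr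
    _ = (|t| ^ (ε + z.re) + |t| ^ (-ε + z.re)) / ε := by
      rw [Real.rpow_add ht0, Real.rpow_add ht0]; ring
    _ ≤ ((|t| ^ a + |t| ^ b) + (|t| ^ a + |t| ^ b)) / ε := by
      gcongr <;> apply hmono <;> linarith
    _ = 2 / ε * (|t| ^ a + |t| ^ b) := by ring

lemma differentiableOn_integral_absPow {e : E} (he : ‖e‖ = 1) {g : E → ℂ} (hg : Continuous g)
    (hgc : HasCompactSupport g) :
    DifferentiableOn ℂ (fun z => ∫ y, absPow z (inner ℝ e y) * g y) {z | -1 < z.re} := by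
  have he0 : e ≠ 0 := by rintro rfl; simp at he
  intro z₀ hz₀
  have hz₀' : -1 < z₀.re := hz₀
  apply DifferentiableAt.differentiableWithinAt
  have hint : ∀ z : ℂ, -1 < z.re → Integrable (fun y => absPow z (inner ℝ e y) * g y) := by
    intro z hz
    simpa using (locallyIntegrable_absPow_inner he hz).integrable_smul_right_of_hasCompactSupport
      hg hgc
  -- A quarter of the distance to the line `Re z = -1`: the ball of radius `ε` plus the margin `ε`
  -- for the logarithm uses `2ε`, which leaves `a > -1`.
  set ε : ℝ := (z₀.re + 1) / 4 with hεdef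
  have hε : 0 < ε := by rw [hεdef]; linarith
  set a : ℝ := z₀.re - 2 * ε
  set b : ℝ := z₀.re + 2 * ε
  have ha : -1 < a := by simp only [a, hεdef]; linarith
  have hb : -1 < b := by simp only [b, hεdef]; linarith
  have hm : ∀ z : ℂ, Measurable fun y : E => absPow z (inner ℝ e y) := fun z =>
    (measurable_absPow z).comp (by fun_prop)
  refine (hasDerivAt_integral_of_dominated_loc_of_deriv_le (𝕜 := ℂ)
    (F' := fun z y => (Real.log (inner ℝ e y) * absPow z (inner ℝ e y)) * g y)
    (bound := fun y => 2 / ε * (‖absPow a (inner ℝ e y) * g y‖ + ‖absPow b (inner ℝ e y) * g y‖))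
    (Metric.ball_mem_nhds z₀ hε) ?_ (hint _ hz₀') ?_ ?_ ?_ ?_).2.differentiableAt
  · exact Eventually.of_forall fun z => ((hm z).mul hg.measurable).aestronglyMeasurable
  · refine (Measurable.mul (Measurable.mul ?_ (hm _)) hg.measurable).aestronglyMeasurable
    fun_prop
  · filter_upwards [ae_inner_ne_zero he0] with y hy z hz
    have hre : |z.re - z₀.re| < ε := by
      have h1 := Complex.abs_re_le_norm (z - z₀)
      rw [Complex.sub_re] at h1
      exact h1.trans_lt (by simpa [dist_eq_norm] using hz)
    rw [abs_lt] at hre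
    rw [norm_mul, norm_mul (absPow (a : ℂ) _), norm_mul (absPow (b : ℂ) _), norm_absPow _ hy,
      norm_absPow _ hy, Complex.ofReal_re, Complex.ofReal_re, ← add_mul, ← mul_assoc]
    gcongr
    exact norm_log_mul_absPow_le hε (by simp only [a]; linarith) (by simp only [b]; linarith) hy
  · exact ((hint a (by simpa using ha)).norm.add (hint b (by simpa using hb)).norm).const_mul _
  · filter_upwards [ae_inner_ne_zero he0] with y hy z hz
    exact (hasDerivAt_absPow_exponent z hy).mul_const _

end LinearForm

/-! ### The reflection quotient and integration by parts -/

section ReflQuot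

variable {E : Type*} [NormedAddCommGroup E] [InnerProductSpace ℝ E]

/-- For a unit vector `e`, with `R` the reflection in `e^⊥` and `t = ⟪e, y⟫`, this is the smooth
function `(∂ₑg(y) - ∂ₑg(R y)) / (2 t)`. -/
def reflQuot (e : E) (g : E → ℂ) (y : E) : ℂ :=
  2⁻¹ * ∫ s in (-1 : ℝ)..1,
    fderiv ℝ (fun w => fderiv ℝ g w e) (y + ((s - 1) * inner ℝ e y) • e) e

/-- Fundamental theorem of calculus for `∂ₑg` along the segment from the mirror image of `y` to `y`.
-/
lemma inner_mul_reflQuot (e : E) {g : E → ℂ} (hg : ContDiff ℝ 2 g) (y : E) :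
    (inner ℝ e y : ℂ) * reflQuot e g y =
      2⁻¹ * (fderiv ℝ g y e - fderiv ℝ g (y - (2 * inner ℝ e y) • e) e) := by
  set t : ℝ := inner ℝ e y
  have hg1 : ContDiff ℝ 1 (fun w => fderiv ℝ g w e) :=
    (hg.fderiv_right (m := 1) (by norm_num)).clm_apply contDiff_const
  have hg0 : Continuous (fun z => fderiv ℝ (fun w => fderiv ℝ g w e) z e) :=
    (hg1.continuous_fderiv one_ne_zero).clm_apply continuous_const
  have hd : ∀ s : ℝ, HasDerivAt (fun s : ℝ => fderiv ℝ g (y + ((s - 1) * t) • e) e)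
      ((t : ℂ) * fderiv ℝ (fun w => fderiv ℝ g w e) (y + ((s - 1) * t) • e) e) s := by
    intro s
    have h1 : HasDerivAt (fun s : ℝ => y + ((s - 1) * t) • e) (t • e) s := by
      have := ((((hasDerivAt_id s).sub_const 1).mul_const t).smul_const e).const_add y
      simpa using this
    have h2 := ((hg1.differentiable one_ne_zero) (y + ((s - 1) * t) • e)).hasFDerivAt.comp_hasDerivAt
      s h1
    refine h2.congr_deriv ?_
    simp
  have hint := intervalIntegral.integral_eq_sub_of_hasDerivAt (a := -1) (b := 1)
    (fun s _ => hd s) (Continuous.intervalIntegrable (by fun_prop) _ _)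
  rw [intervalIntegral.integral_const_mul] at hint
  rw [reflQuot, mul_left_comm, hint]
  congr 3
  · simp
  · congr 1
    module

/-- The segment may cross the support of `g` although its endpoints do not. Off the hyperplane only
the endpoints matter, and reflection preserves the norm; on the hyperplane the segment is the single
point `y`. -/
lemma reflQuot_eq_zero {e : E} {g : E → ℂ} (hg : ContDiff ℝ 2 g) (he : ‖e‖ = 1) {R : ℝ}
    (hR : ∀ y, R < ‖y‖ → g y = 0) {y : E} (hy : R < ‖y‖) : reflQuot e g y = 0 := by
  have h0 : ∀ z, R < ‖z‖ → g =ᶠ[𝓝 z] fun _ => 0 := fun z hz => by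
    filter_upwards [(isOpen_lt continuous_const continuous_norm).mem_nhds hz] with w hw using hR w hw
  have h1 : ∀ z, R < ‖z‖ → fderiv ℝ g z e = 0 := fun z hz => by simp [(h0 z hz).fderiv_eq]
  by_cases ht : inner ℝ e y = 0
  · have h2 : (fun w => fderiv ℝ g w e) =ᶠ[𝓝 y] fun _ => 0 := by
      filter_upwards [(isOpen_lt continuous_const continuous_norm).mem_nhds hy] with w hw
        using h1 w hw
    simp [reflQuot, ht, h2.fderiv_eq]
  · have hn : ‖y - (2 * inner ℝ e y) • e‖ = ‖y‖ := by
      rw [← sq_eq_sq₀ (norm_nonneg _) (norm_nonneg _), @norm_sub_sq_real, norm_smul, he,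
        inner_smul_right, real_inner_comm y e, mul_one, Real.norm_eq_abs, sq_abs]
      rw [real_inner_comm e y]
      ring
    have h := inner_mul_reflQuot e hg y
    rw [h1 y hy, h1 _ (hn ▸ hy)] at h
    simpa [ht] using h

variable {P : Type*} [NormedAddCommGroup P] [NormedSpace ℝ P] {s : Set P} {R : ℝ} {g : P → E → ℂ}

lemma SmoothFamily.reflQuot (hg : SmoothFamily ⊤ s R g) (hs : IsOpen s) {e : E} (he : ‖e‖ = 1) :
    SmoothFamily ⊤ s R (fun p => reflQuot e (g p)) := by
  have hg2 := (hg.fderiv_right (k := ⊤) (by simp) e).fderiv_right (k := ⊤) (by simp) e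
  refine ⟨fun p hp y => ?_, fun p hp y hy =>
    reflQuot_eq_zero ((hg.of_le (k := 2) le_top).contDiff_right hp) he (hg.zero p hp) hy⟩
  -- The integration variable `σ` plays the role of the point and `(p, y)` that of the parameter.
  -- The cutoff `χ`, equal to `1` on `[-1, 1]`, supplies the compact support that `SmoothFamily`
  -- demands.
  let χ : ContDiffBump (0 : ℝ) := ⟨1, 2, one_pos, one_lt_two⟩
  have hfam : SmoothFamily ⊤ (s ×ˢ (univ : Set E)) 2 (fun (z : P × E) (σ : ℝ) => ((χ σ : ℝ) : ℂ) *
      fderiv ℝ (fun w => fderiv ℝ (g z.1) w e) (z.2 + ((σ - 1) * inner ℝ e z.2) • e) e) := by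
    refine ⟨?_, ?_⟩
    · rintro ⟨q, w⟩ ⟨hq, -⟩ σ
      refine ContDiffAt.mul ?_ ?_
      · exact Complex.ofRealCLM.contDiff.contDiffAt.comp _ (χ.contDiff.contDiffAt.comp _ contDiffAt_snd)
      · refine (hg2.smooth q hq (w + ((σ - 1) * inner ℝ e w) • e)).comp
          (f := fun z : (P × E) × ℝ => (z.1.1, z.1.2 + ((z.2 - 1) * inner ℝ e z.1.2) • e))
          ((q, w), σ) ?_
        refine ContDiffAt.prodMk (contDiffAt_fst.comp _ contDiffAt_fst) ?_
        have hi : ContDiffAt ℝ (⊤ : ℕ∞) (fun z : (P × E) × ℝ => inner ℝ e z.1.2) ((q, w), σ) :=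
          contDiffAt_const.inner ℝ (contDiffAt_snd.comp _ contDiffAt_fst)
        exact (contDiffAt_snd.comp _ contDiffAt_fst).add
          (((contDiffAt_snd.sub contDiffAt_const).mul hi).smul contDiffAt_const)
    · rintro ⟨q, w⟩ - σ hσ
      have : χ σ = 0 := χ.zero_of_le_dist (by simpa using hσ.le)
      simp [this]
  have hf : LocallyIntegrable ((Ioc (-1 : ℝ) 1).indicator fun _ => (2⁻¹ : ℂ)) :=
    ((integrable_indicator_iff measurableSet_Ioc).2 (by simp)).locallyIntegrable
  have h := (hfam.contDiffOn_integral (hs.prod isOpen_univ) hf).contDiffAt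
    ((hs.prod isOpen_univ).mem_nhds (⟨hp, mem_univ y⟩ : (p, y) ∈ s ×ˢ univ))
  refine h.congr_of_eventuallyEq (Eventually.of_forall fun z => ?_)
  simp only [Function.uncurry, CosineTransform.reflQuot]
  rw [intervalIntegral.integral_of_le (by norm_num), ← integral_const_mul,
    ← integral_indicator measurableSet_Ioc]
  congr 1 with σ
  by_cases hσ : σ ∈ Ioc (-1 : ℝ) 1
  · have : χ σ = 1 := χ.one_of_mem_closedBall (by
      simpa [abs_le] using ⟨hσ.1.le, hσ.2⟩)
    simp [hσ, this]
  · simp [hσ]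

lemma SmoothFamily.iterate_reflQuot (hg : SmoothFamily ⊤ s R g) (hs : IsOpen s) {e : E}
    (he : ‖e‖ = 1) (k : ℕ) : SmoothFamily ⊤ s R (fun p => (CosineTransform.reflQuot e)^[k] (g p)) := by
  induction k with
  | zero => simpa using hg
  | succ k ih =>
    simp only [Function.iterate_succ_apply']
    exact ih.reflQuot hs he

variable [FiniteDimensional ℝ E] [MeasurableSpace E] [BorelSpace E]

/-- With `t = ⟪e, y⟫`, the function `u = t|t|^z` is odd under the reflection and `∂ₑu = (z+1)|t|^z`.
By `inner_mul_reflQuot` the left integrand is `u` times half the difference of `∂ₑg` and its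
reflection. Oddness merges the two halves into `∫ u ∂ₑg`, which is then integrated by parts. -/
lemma integral_absPow_mul_reflQuot {e : E} (he : ‖e‖ = 1) {g : E → ℂ} (hg : ContDiff ℝ 2 g)
    (hgc : HasCompactSupport g) {z : ℂ} (hz : 0 < z.re) :
    ∫ y, absPow (z + 2) (inner ℝ e y) * reflQuot e g y =
      -(z + 1) * ∫ y, absPow z (inner ℝ e y) * g y := by
  have he0 : e ≠ 0 := by rintro rfl; simp at he
  have hz0 : z ≠ 0 := by rintro rfl; simp at hz
  have hz2 : z + 2 ≠ 0 := by
    intro h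
    have := congrArg Complex.re h
    simp at this
    linarith
  set u : E → ℂ := fun y => (inner ℝ e y : ℂ) * absPow z (inner ℝ e y) with hu
  have hig : ∀ y : E, HasFDerivAt (fun y : E => (inner ℝ e y : ℝ)) (innerSL ℝ e) y := fun y =>
    (innerSL ℝ e).hasFDerivAt
  have hud : ∀ y, HasFDerivAt u (((z + 1) * absPow z (inner ℝ e y)) •
      (Complex.ofRealCLM.comp (innerSL ℝ e))) y := by
    intro y
    have h := (hasDerivAt_mul_absPow hz (inner ℝ e y)).hasFDerivAt.comp y (hig y)
    refine h.congr_fderiv ?_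
    ext v
    simp [mul_comm]
  have huc : Continuous u := (Complex.continuous_ofReal.comp (by fun_prop)).mul
    ((continuous_absPow hz).comp (by fun_prop))
  have hac : Continuous fun y : E => absPow z (inner ℝ e y) :=
    (continuous_absPow hz).comp (by fun_prop)
  have hDc : Continuous fun y => fderiv ℝ g y e :=
    (hg.continuous_fderiv two_ne_zero).clm_apply continuous_const
  have hDs : HasCompactSupport fun y => fderiv ℝ g y e := hgc.fderiv_apply ℝ e
  have hI1 : Integrable fun y => u y * fderiv ℝ g y e :=
    (huc.mul hDc).integrable_of_hasCompactSupport hDs.mul_left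
  have hfu : ∀ y, fderiv ℝ u y e = (z + 1) * absPow z (inner ℝ e y) := by
    intro y
    rw [(hud y).fderiv]
    simp [he]
  have hI2 : Integrable fun y => fderiv ℝ u y e * g y := by
    simp only [hfu]
    exact ((continuous_const.mul hac).mul hg.continuous).integrable_of_hasCompactSupport
      hgc.mul_left
  have hI3 : Integrable fun y => u y * g y :=
    (huc.mul hg.continuous).integrable_of_hasCompactSupport hgc.mul_left
  have hibp := integral_mul_fderiv_eq_neg_fderiv_mul_of_integrable hI2 hI1 hI3
    (fun y _ => (hud y).differentiableAt) (fun y _ => (hg.differentiable two_ne_zero) y)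
  simp only [hfu, mul_assoc, integral_const_mul] at hibp
  let ρ : E ≃ₗᵢ[ℝ] E := (ℝ ∙ e)ᗮ.reflection
  have hρ : ∀ y, ρ y = y - (2 * inner ℝ e y) • e := by
    intro y
    simp only [ρ, Submodule.reflection_orthogonal_apply, Submodule.reflection_singleton_apply, he]
    simp [mul_smul, two_smul]
  have hρu : ∀ y, u (ρ y) = -u y := by
    intro y
    have : (inner ℝ e (ρ y) : ℝ) = -inner ℝ e y := by
      rw [hρ, inner_sub_right, inner_smul_right, real_inner_self_eq_norm_sq, he]
      ring
    simp [u, this]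
  have hrefl : ∫ y, u y * fderiv ℝ g (ρ y) e = -∫ y, u y * fderiv ℝ g y e := by
    rw [← ρ.measurePreserving.integral_comp ρ.toMeasurableEquiv.measurableEmbedding
      (fun y => u y * fderiv ℝ g y e), ← integral_neg]
    simp [hρu]
  have hI4 : Integrable fun y => u y * fderiv ℝ g (ρ y) e :=
    (huc.mul (hDc.comp ρ.continuous)).integrable_of_hasCompactSupport
      ((hDs.comp_homeomorph ρ.toHomeomorph).mul_left)
  calc ∫ y, absPow (z + 2) (inner ℝ e y) * reflQuot e g y
      = ∫ y, (2⁻¹ * (u y * fderiv ℝ g y e) - 2⁻¹ * (u y * fderiv ℝ g (ρ y) e)) := by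
        congr 1 with y
        have h := inner_mul_reflQuot e hg y
        rw [← hρ] at h
        rcases eq_or_ne (inner ℝ e y) 0 with ht | ht
        · simp [u, ht, absPow_zero_right hz2]
        · rw [absPow_add_two z ht]
          simp only [u]
          linear_combination (absPow z (inner ℝ e y) * (inner ℝ e y : ℂ)) * h
    _ = ∫ y, u y * fderiv ℝ g y e := by
        rw [integral_sub (hI1.const_mul _) (hI4.const_mul _), integral_const_mul,
          integral_const_mul, hrefl]
        ring
    _ = _ := by rw [hibp]; ring

end ReflQuot

/-! ### The identity theorem on half planes -/

section IdentityPrinciple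

lemma isOpen_halfPlane (c : ℝ) : IsOpen {z : ℂ | c < z.re} :=
  isOpen_lt continuous_const Complex.continuous_re

lemma eqOn_halfPlane {f g : ℂ → ℂ} {c d : ℝ} (hf : DifferentiableOn ℂ f {z | c < z.re})
    (hg : DifferentiableOn ℂ g {z | c < z.re}) (h : ∀ z : ℂ, d < z.re → f z = g z) :
    EqOn f g {z | c < z.re} := by
  -- A base point in both half planes.
  have hz : ((max c d + 1 : ℝ) : ℂ) ∈ {z : ℂ | c < z.re} := by
    simp only [mem_ofPred_eq, Complex.ofReal_re]
    linarith [le_max_left c d]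
  refine (hf.analyticOnNhd (isOpen_halfPlane c)).eqOn_of_preconnected_of_eventuallyEq
    (hg.analyticOnNhd (isOpen_halfPlane c)) (convex_halfSpace_re_gt c).isPreconnected hz ?_
  filter_upwards [(isOpen_halfPlane d).mem_nhds (x := ((max c d + 1 : ℝ) : ℂ)) (by
    simp only [mem_ofPred_eq, Complex.ofReal_re]
    linarith [le_max_right c d])] with z hz using h z hz

lemma eq_of_eq_on_halfPlane {f g : ℂ → ℂ} {d : ℝ} (hf : Differentiable ℂ f)
    (hg : Differentiable ℂ g) (h : ∀ z : ℂ, d < z.re → f z = g z) : f = g := by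
  ext z
  exact eqOn_halfPlane (c := z.re - 1) hf.differentiableOn hg.differentiableOn h
    (by simp)

end IdentityPrinciple

/-- A dummy real parameter makes the results on families available for a single test function. -/
lemma smoothFamily_const {E : Type*} [NormedAddCommGroup E] [NormedSpace ℝ E]
    {h : E → ℂ} (hh : ContDiff ℝ ∞ h) {R : ℝ} (hR : ∀ y, R < ‖y‖ → h y = 0) :
    SmoothFamily ⊤ (univ : Set ℝ) R (fun _ => h) :=
  ⟨fun p _ y => hh.contDiffAt.comp (p, y) contDiffAt_snd, fun _ _ => hR⟩

lemma exists_radius {E : Type*} [NormedAddCommGroup E] {h : E → ℂ} (hc : HasCompactSupport h) :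
    ∃ R, 0 < R ∧ ∀ y, R < ‖y‖ → h y = 0 := by
  obtain ⟨R, hR0, hR⟩ := hc.isCompact.isBounded.subset_closedBall_lt 0 0
  refine ⟨R, hR0, fun y hy => image_eq_zero_of_notMem_tsupport fun hy' => ?_⟩
  have : ‖y‖ ≤ R := by simpa using hR hy'
  linarith

section IterateReflQuot

variable {E : Type*} [NormedAddCommGroup E] [InnerProductSpace ℝ E]
  {e : E} (he : ‖e‖ = 1) {h : E → ℂ} (hh : ContDiff ℝ ∞ h) (hc : HasCompactSupport h)

include he hh hc

lemma contDiff_iterate_reflQuot (k : ℕ) : ContDiff ℝ ∞ ((reflQuot e)^[k] h) := by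
  obtain ⟨R, -, hR⟩ := exists_radius hc
  exact ((smoothFamily_const hh hR).iterate_reflQuot isOpen_univ he k).contDiff_right
    (mem_univ (0 : ℝ))

variable [FiniteDimensional ℝ E]

lemma hasCompactSupport_iterate_reflQuot (k : ℕ) : HasCompactSupport ((reflQuot e)^[k] h) := by
  obtain ⟨R, -, hR⟩ := exists_radius hc
  exact ((smoothFamily_const hh hR).iterate_reflQuot isOpen_univ he k).hasCompactSupport
    (mem_univ (0 : ℝ))

end IterateReflQuot

/-! ### Entire continuation for a fixed hyperplane -/

section HyperplaneRegularization

variable {E : Type*} [NormedAddCommGroup E] [InnerProductSpace ℝ E] [FiniteDimensional ℝ E]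
  [MeasurableSpace E] [BorelSpace E]

/-- The formula for the analytic continuation to `Re μ > -1 - 2k` of
`μ ↦ Γ((μ+1)/2)⁻¹ ∫ |⟪e, y⟫|^μ h(y) dy`. -/
def hyperplaneReg (e : E) (k : ℕ) (h : E → ℂ) (μ : ℂ) : ℂ :=
  (-1 / 2) ^ k * (Complex.Gamma ((μ + 1) / 2 + k))⁻¹ *
    ∫ y, absPow (μ + 2 * k) (inner ℝ e y) * (reflQuot e)^[k] h y

lemma differentiableOn_normalizedIntegral {e : E} (he : ‖e‖ = 1) (k : ℕ) {g : E → ℂ}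
    (hg : Continuous g) (hgc : HasCompactSupport g) :
    DifferentiableOn ℂ (fun μ : ℂ => (-1 / 2) ^ k * (Complex.Gamma ((μ + 1) / 2 + k))⁻¹ *
      ∫ y, absPow (μ + 2 * k) (inner ℝ e y) * g y) {μ | -1 - 2 * (k : ℝ) < μ.re} := by
  have h1 : Differentiable ℂ fun μ : ℂ => (Complex.Gamma ((μ + 1) / 2 + k))⁻¹ :=
    Complex.differentiable_one_div_Gamma.comp (f := fun μ : ℂ => (μ + 1) / 2 + k) (by fun_prop)
  have h2 : DifferentiableOn ℂ (fun μ : ℂ => ∫ y, absPow (μ + 2 * k) (inner ℝ e y) * g y)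
      {μ | -1 - 2 * (k : ℝ) < μ.re} := by
    refine (differentiableOn_integral_absPow he hg hgc).comp (f := fun μ : ℂ => μ + 2 * k)
      (by fun_prop) fun μ hμ => ?_
    have : -1 - 2 * (k : ℝ) < μ.re := hμ
    simp
    linarith
  exact (h1.const_mul _).differentiableOn.mul h2

section

variable {e : E} (he : ‖e‖ = 1) {h : E → ℂ} (hh : ContDiff ℝ ∞ h) (hc : HasCompactSupport h)

include he hh hc

lemma differentiableOn_hyperplaneReg (k : ℕ) :
    DifferentiableOn ℂ (hyperplaneReg e k h) {μ | -1 - 2 * (k : ℝ) < μ.re} :=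
  differentiableOn_normalizedIntegral he k (contDiff_iterate_reflQuot he hh hc k).continuous
    (hasCompactSupport_iterate_reflQuot he hh hc k)

/-- Integration by parts yields `-(μ+2k+1)`, which is `-2` times the factor `(μ+1)/2 + k` from the
Gamma recursion; the extra `-1/2` cancels the rest. -/
lemma hyperplaneReg_succ (k : ℕ) {μ : ℂ} (hμ : 0 < μ.re) :
    hyperplaneReg e (k + 1) h μ = hyperplaneReg e k h μ := by
  have h2 : ContDiff ℝ 2 ((reflQuot e)^[k] h) :=
    mod_cast contDiff_infty.1 (contDiff_iterate_reflQuot he hh hc k) 2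
  have hre : 0 < (μ + 2 * k).re := by
    simp
    positivity
  have hibp := integral_absPow_mul_reflQuot he h2
    (hasCompactSupport_iterate_reflQuot he hh hc k) hre
  have hne : (μ + 1) / 2 + k ≠ 0 := by
    intro h0
    have := congrArg Complex.re h0
    simp at this
    have hk : (0 : ℝ) ≤ k := Nat.cast_nonneg k
    linarith
  have hΓ : Complex.Gamma ((μ + 1) / 2 + (k + 1 : ℕ)) =
      ((μ + 1) / 2 + k) * Complex.Gamma ((μ + 1) / 2 + k) := by
    rw [← Complex.Gamma_add_one _ hne]
    push_cast
    ring_nf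
  have hz : μ + 2 * ((k + 1 : ℕ) : ℂ) = μ + 2 * k + 2 := by push_cast; ring
  simp only [hyperplaneReg, Function.iterate_succ_apply']
  rw [hz, hibp, hΓ, mul_inv, pow_succ]
  have : μ + 2 * k + 1 ≠ 0 := by
    intro h0
    apply hne
    linear_combination h0 / 2
  have h3 : ((μ + 1) / 2 + k)⁻¹ = 2 / (μ + 2 * k + 1) := by
    rw [show (μ + 1) / 2 + k = (μ + 2 * k + 1) / 2 by ring, inv_div]
  rw [h3]
  field_simp

lemma hyperplaneReg_eq_zero_index (k : ℕ) {μ : ℂ} (hμ : 0 < μ.re) :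
    hyperplaneReg e k h μ = hyperplaneReg e 0 h μ := by
  induction k with
  | zero => rfl
  | succ k ih => rw [hyperplaneReg_succ he hh hc k hμ, ih]

lemma hyperplaneReg_eq {k l : ℕ} {μ : ℂ} (hk : -1 - 2 * (k : ℝ) < μ.re)
    (hl : -1 - 2 * (l : ℝ) < μ.re) : hyperplaneReg e k h μ = hyperplaneReg e l h μ := by
  wlog hkl : k ≤ l generalizing k l
  · exact (this hl hk (le_of_not_ge hkl)).symm
  have hkl' : (k : ℝ) ≤ l := by exact_mod_cast hkl
  refine eqOn_halfPlane (d := 0) (differentiableOn_hyperplaneReg he hh hc k)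
    ((differentiableOn_hyperplaneReg he hh hc l).mono fun z hz => ?_) (fun z hz => ?_) hk
  · have : -1 - 2 * (k : ℝ) < z.re := hz
    simp only [mem_ofPred_eq]
    linarith
  · rw [hyperplaneReg_eq_zero_index he hh hc k hz, hyperplaneReg_eq_zero_index he hh hc l hz]

lemma exists_entire_hyperplaneReg : ∃ a : ℂ → ℂ, Differentiable ℂ a ∧
    ∀ (k : ℕ) (μ : ℂ), -1 - 2 * (k : ℝ) < μ.re → a μ = hyperplaneReg e k h μ := by
  have hex : ∀ x : ℝ, -1 - 2 * ((⌈|x|⌉₊ : ℕ) : ℝ) < x := fun x => by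
    have h1 := Nat.le_ceil |x|
    have h2 := neg_abs_le x
    have h3 := abs_nonneg x
    linarith
  have heq : ∀ (k : ℕ) (μ : ℂ), -1 - 2 * (k : ℝ) < μ.re →
      hyperplaneReg e ⌈|μ.re|⌉₊ h μ = hyperplaneReg e k h μ := fun k μ hk =>
    hyperplaneReg_eq he hh hc (hex _) hk
  refine ⟨fun μ => hyperplaneReg e ⌈|μ.re|⌉₊ h μ, fun μ => ?_, heq⟩
  -- The index `k` in the definition jumps with `μ`, but near a given point the formula with that
  -- point's index stays valid.
  have hmem := (isOpen_halfPlane (-1 - 2 * ((⌈|μ.re|⌉₊ : ℕ) : ℝ))).mem_nhds (hex μ.re)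
  refine ((differentiableOn_hyperplaneReg he hh hc _).differentiableAt hmem).congr_of_eventuallyEq ?_
  filter_upwards [hmem] with z hz using heq _ z hz

end

end HyperplaneRegularization

/-! ### Straightening the hyperplane `x^⊥` to `e^⊥` -/

section Chart

variable {E : Type*} [NormedAddCommGroup E] [InnerProductSpace ℝ E]

/-- The density of the push-forward of `G(y) dy` under a linear map taking the linear form
`⟪x, ·⟫` to `⟪e, ·⟫`, for `⟪x, e⟫ > 0`. -/
def chart (e : E) (G : E → ℂ) (x y : E) : ℂ :=
  ((inner ℝ x e : ℝ) : ℂ)⁻¹ * G (y + ((inner ℝ e y - inner ℝ x y) / inner ℝ x e) • e)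

/-- The argument `z` of `G` satisfies `y = z + ⟪x - e, z⟫ e`, hence `‖y‖ ≤ (1 + ‖x - e‖)‖z‖ ≤ (ρ +
2)‖z‖`; this explains the radius. -/
lemma smoothFamily_chart {e : E} (he : ‖e‖ = 1) {G : E → ℂ} (hG : ContDiff ℝ ∞ G) {R : ℝ}
    (hR : ∀ y, R < ‖y‖ → G y = 0) (ρ : ℝ) :
    SmoothFamily ⊤ {x : E | 0 < inner ℝ x e ∧ ‖x‖ < ρ} (R * (ρ + 2)) (chart e G) := by
  refine ⟨fun x hx y => ?_, fun x hx y hy => ?_⟩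
  · have hi : ContDiffAt ℝ ∞ (fun z : E × E => (inner ℝ z.1 e : ℝ)) (x, y) :=
      contDiffAt_fst.inner ℝ contDiffAt_const
    have hj : ContDiffAt ℝ ∞ (fun z : E × E => (inner ℝ e z.2 : ℝ)) (x, y) :=
      contDiffAt_const.inner ℝ contDiffAt_snd
    have hk : ContDiffAt ℝ ∞ (fun z : E × E => (inner ℝ z.1 z.2 : ℝ)) (x, y) :=
      contDiffAt_fst.inner ℝ contDiffAt_snd
    refine ContDiffAt.mul ?_ ?_
    · refine ContDiffAt.inv (Complex.ofRealCLM.contDiff.contDiffAt.comp _ hi) ?_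
      simpa using hx.1.ne'
    · refine hG.contDiffAt.comp (x, y) ?_
      exact contDiffAt_snd.add (((hj.sub hk).div hi hx.1.ne').smul contDiffAt_const)
  · rw [chart]
    set z := y + ((inner ℝ e y - inner ℝ x y) / inner ℝ x e) • e with hz
    have hy2 : y = z + (inner ℝ (x - e) z : ℝ) • e := by
      have h1 : (inner ℝ (x - e) z : ℝ) = -((inner ℝ e y - inner ℝ x y) / inner ℝ x e) := by
        rw [hz, inner_add_right, inner_smul_right, inner_sub_left, inner_sub_left,
          real_inner_self_eq_norm_sq, he]
        have := hx.1.ne'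
        field_simp
        ring
      rw [h1, hz]
      module
    have hn : ‖y‖ ≤ ‖z‖ * (ρ + 2) := by
      have h1 : ‖(inner ℝ (x - e) z : ℝ) • e‖ ≤ (ρ + 1) * ‖z‖ := by
        rw [norm_smul, he, mul_one]
        refine (norm_inner_le_norm _ _).trans ?_
        gcongr
        linarith [norm_sub_le x e, hx.2]
      calc ‖y‖ ≤ ‖z‖ + ‖(inner ℝ (x - e) z : ℝ) • e‖ := by
            conv_lhs => rw [hy2]
            exact norm_add_le _ _
        _ ≤ ‖z‖ * (ρ + 2) := by linarith
    have hρ : 0 < ρ := (norm_nonneg x).trans_lt hx.2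
    have : R < ‖z‖ := by
      by_contra hcon
      push Not at hcon
      have := mul_le_mul_of_nonneg_right hcon (by linarith : 0 ≤ ρ + 2)
      linarith
    rw [hR z this, mul_zero]

variable [FiniteDimensional ℝ E] [MeasurableSpace E] [BorelSpace E]

/-- Change of variables along the transvection `C y = y + ⟪x - e, y⟫ e`, for which `⟪e, C y⟫ = ⟪x,
y⟫` and `det C = 1 + ⟪x - e, e⟫ = ⟪x, e⟫`. -/
lemma integral_chart {e : E} (he : ‖e‖ = 1) {G : E → ℂ} (hG : Continuous G) {x : E}
    (hx : 0 < inner ℝ x e) (z : ℂ) :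
    ∫ y, absPow z (inner ℝ e y) * chart e G x y = ∫ y, absPow z (inner ℝ x y) * G y := by
  set C : E →ₗ[ℝ] E := LinearMap.transvection (innerSL ℝ (x - e) : E →ₗ[ℝ] ℝ) e with hC
  have hCapp : ∀ y, C y = y + (inner ℝ (x - e) y : ℝ) • e := fun y => rfl
  have hdet : LinearMap.det C = inner ℝ x e := by
    rw [hC, LinearMap.transvection.det]
    simp [he]
  have hne : LinearMap.det C ≠ 0 := hdet ▸ hx.ne'
  have hmap := Measure.map_linearMap_addHaar_eq_smul_addHaar (volume : Measure E) hne
  set F : E → ℂ := fun y => absPow z (inner ℝ e y) * chart e G x y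
  have hF : Measurable F := by
    refine ((measurable_absPow z).comp (by fun_prop)).mul ?_
    refine Continuous.measurable ?_
    unfold chart
    exact continuous_const.mul (hG.comp (by fun_prop))
  have h1 : ∫ y, F (C y) = |(LinearMap.det C)⁻¹| • ∫ y, F y := by
    rw [← integral_map (f := F) (LinearMap.continuous_of_finiteDimensional C).measurable.aemeasurable
      hF.aestronglyMeasurable, hmap, integral_smul_measure,
      ENNReal.toReal_ofReal (abs_nonneg _)]
  have h2 : ∀ y, F (C y) = ((inner ℝ x e : ℝ) : ℂ)⁻¹ * (absPow z (inner ℝ x y) * G y) := by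
    intro y
    have e1 : (inner ℝ e (C y) : ℝ) = inner ℝ x y := by
      rw [hCapp, inner_add_right, inner_smul_right, real_inner_self_eq_norm_sq, he, inner_sub_left]
      ring
    have e2 : (inner ℝ x (C y) : ℝ) = inner ℝ x y + inner ℝ (x - e) y * inner ℝ x e := by
      rw [hCapp, inner_add_right, inner_smul_right]
    have e3 : C y + ((inner ℝ e (C y) - inner ℝ x (C y)) / inner ℝ x e) • e = y := by
      rw [e1, e2, hCapp]
      have : (inner ℝ x y - (inner ℝ x y + inner ℝ (x - e) y * inner ℝ x e)) / inner ℝ x e =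
          -(inner ℝ (x - e) y : ℝ) := by
        field_simp
        ring
      rw [this]
      module
    simp only [F, chart]
    rw [e3, e1]
    ring
  simp only [h2] at h1
  rw [integral_const_mul, hdet, abs_of_pos (inv_pos.mpr hx), Complex.real_smul,
    Complex.ofReal_inv] at h1
  have : ((inner ℝ x e : ℝ) : ℂ)⁻¹ ≠ 0 := by simpa using hx.ne'
  exact (mul_left_cancel₀ this h1).symm

end Chart

/-! ### Choice of half plane and chart; the Laplacian of `|⟪z, y⟫|^μ` -/

lemma exists_nat_halfPlane (r : ℝ) : ∃ k : ℕ, -1 - 2 * (k : ℝ) < r := by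
  obtain ⟨k, hk⟩ := exists_nat_gt |r|
  have h2 := neg_abs_le r
  have h3 := abs_nonneg r
  exact ⟨k, by linarith⟩

section

variable {E : Type*} [NormedAddCommGroup E] [InnerProductSpace ℝ E]

lemma exists_chart {x : E} (hx : x ≠ 0) : ∃ e : E, ‖e‖ = 1 ∧ 0 < inner ℝ x e := by
  have hn : 0 < ‖x‖ := norm_pos_iff.mpr hx
  refine ⟨‖x‖⁻¹ • x, by rw [norm_smul, norm_inv, norm_norm, inv_mul_cancel₀ hn.ne'], ?_⟩
  rw [inner_smul_right, real_inner_self_eq_norm_sq]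
  positivity

variable [FiniteDimensional ℝ E]

lemma laplacian_absPow_inner {μ : ℂ} (hμ : 2 < μ.re) (x y : E) (c : ℂ) :
    Laplacian.laplacian (fun z : E => absPow μ (inner ℝ z y) * c) x =
      μ * (μ - 1) * (absPow (μ - 2) (inner ℝ x y) * ((‖y‖ : ℂ) ^ 2 * c)) := by
  set φ : ℝ → ℂ := fun t => absPow μ t * c
  have hφ : ContDiff ℝ 2 φ := (contDiff_absPow hμ).mul contDiff_const
  have hφ2 : ∀ t, iteratedDeriv 2 φ t = μ * ((μ - 1) * absPow (μ - 2) t) * c := by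
    intro t
    have h1 : deriv φ = fun t => deriv (absPow μ) t * c := by
      ext t
      exact deriv_mul_const (hasDerivAt_absPow hμ t).differentiableAt _
    have h2 : deriv (deriv (absPow μ)) t = _ := congrFun (deriv_deriv_absPow hμ) t
    rw [iteratedDeriv_succ, iteratedDeriv_one, h1, deriv_mul_const, h2]
    rw [deriv_absPow hμ]
    exact ((hasDerivAt_mul_absPow (z := μ - 2) (by simpa using hμ) t).const_mul μ).differentiableAt
  have hcomp : (fun z : E => absPow μ (inner ℝ z y) * c) = φ ∘ (innerSL ℝ y) := by
    ext z
    simp [φ, real_inner_comm]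
  rw [hcomp, InnerProductSpace.laplacian_eq_iteratedFDeriv_stdOrthonormalBasis]
  have hi : ∀ i, iteratedFDeriv ℝ 2 (φ ∘ (innerSL ℝ y)) x
      ![stdOrthonormalBasis ℝ E i, stdOrthonormalBasis ℝ E i] =
      ((‖inner ℝ y (stdOrthonormalBasis ℝ E i)‖ ^ 2 : ℝ) : ℂ) * iteratedDeriv 2 φ (inner ℝ y x) := by
    intro i
    rw [ContinuousLinearMap.iteratedFDeriv_comp_right _ hφ _ (by norm_num)]
    rw [ContinuousMultilinearMap.compContinuousLinearMap_apply,
      iteratedFDeriv_apply_eq_iteratedDeriv_mul_prod]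
    simp [Fin.prod_univ_two, ← sq]
  simp only [hi]
  rw [← Finset.sum_mul, ← Complex.ofReal_sum, (stdOrthonormalBasis ℝ E).sum_sq_norm_inner_left,
    hφ2, real_inner_comm]
  push_cast
  ring

end

/-! ### The regularized integral as a function of `x` and `μ` -/

section Regularization

variable {E : Type*} [NormedAddCommGroup E] [InnerProductSpace ℝ E]
  [MeasurableSpace E] [BorelSpace E]

/-- `a` is the entire continuation of `μ ↦ Γ((μ+1)/2)⁻¹ ∫ |⟪x, y⟫|^μ G(y) dy`. -/
def IsReg [FiniteDimensional ℝ E] (G : E → ℂ) (x : E) (a : ℂ → ℂ) : Prop :=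
  Differentiable ℂ a ∧ ∀ μ : ℂ, -1 < μ.re →
    a μ = (Complex.Gamma ((μ + 1) / 2))⁻¹ * ∫ y, absPow μ (inner ℝ x y) * G y

/-- The entire continuation of `μ ↦ Γ((μ+1)/2)⁻¹ ∫ |⟪x, y⟫|^μ G(y) dy`, for `x ≠ 0` and a test
function `G`. -/
def reg [FiniteDimensional ℝ E] (G : E → ℂ) (x : E) : ℂ → ℂ := Classical.epsilon (IsReg G x)

variable [FiniteDimensional ℝ E]

lemma IsReg.unique {G : E → ℂ} {x : E} {a b : ℂ → ℂ} (ha : IsReg G x a) (hb : IsReg G x b) :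
    a = b :=
  eq_of_eq_on_halfPlane ha.1 hb.1 fun z hz => (ha.2 z hz).trans (hb.2 z hz).symm

variable {G : E → ℂ} (hG : ContDiff ℝ ∞ G) (hc : HasCompactSupport G)

include hG hc

lemma exists_isReg_chart {e x : E} (he : ‖e‖ = 1) (hx : 0 < inner ℝ x e) : ∃ a, IsReg G x a ∧
    ∀ (k : ℕ) (μ : ℂ), -1 - 2 * (k : ℝ) < μ.re → a μ = hyperplaneReg e k (chart e G x) μ := by
  obtain ⟨R, -, hR⟩ := exists_radius hc
  have hfam := smoothFamily_chart he hG hR (‖x‖ + 1)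
  have hmem : x ∈ {z : E | 0 < inner ℝ z e ∧ ‖z‖ < ‖x‖ + 1} := ⟨hx, by simp⟩
  obtain ⟨a, ha, hak⟩ := exists_entire_hyperplaneReg he (hfam.contDiff_right hmem)
    (hfam.hasCompactSupport hmem)
  refine ⟨a, ⟨ha, fun μ hμ => ?_⟩, hak⟩
  rw [hak 0 μ (by simpa using hμ)]
  simp [hyperplaneReg, integral_chart he hG.continuous hx]

lemma isReg_reg {x : E} (hx : x ≠ 0) : IsReg G x (reg G x) := by
  obtain ⟨e, he, hxe⟩ := exists_chart hx
  obtain ⟨a, ha, -⟩ := exists_isReg_chart hG hc he hxe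
  exact Classical.epsilon_spec ⟨a, ha⟩

lemma reg_eq_hyperplaneReg {e x : E} (he : ‖e‖ = 1) (hx : 0 < inner ℝ x e) {k : ℕ} {μ : ℂ}
    (hμ : -1 - 2 * (k : ℝ) < μ.re) : reg G x μ = hyperplaneReg e k (chart e G x) μ := by
  have hx0 : x ≠ 0 := by rintro rfl; simp at hx
  obtain ⟨a, ha, hak⟩ := exists_isReg_chart hG hc he hx
  rw [(isReg_reg hG hc hx0).unique ha, hak k μ hμ]

/-- Local structure of `reg G · μ`: an integral against a smooth family. -/
lemma exists_smoothFamily_reg {x : E} (hx : x ≠ 0) : ∃ (s : Set E) (e : E) (R : ℝ)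
    (Θ : ℕ → E → E → ℂ), IsOpen s ∧ x ∈ s ∧ ‖e‖ = 1 ∧ (∀ k, SmoothFamily ⊤ s R (Θ k)) ∧
    ∀ (k : ℕ) (μ : ℂ), -1 - 2 * (k : ℝ) < μ.re → ∀ z ∈ s, reg G z μ =
      (-1 / 2) ^ k * (Complex.Gamma ((μ + 1) / 2 + k))⁻¹ *
        ∫ y, absPow (μ + 2 * k) (inner ℝ e y) * Θ k z y := by
  obtain ⟨e, he, hxe⟩ := exists_chart hx
  obtain ⟨R, -, hR⟩ := exists_radius hc
  have hs : IsOpen {z : E | 0 < inner ℝ z e ∧ ‖z‖ < ‖x‖ + 1} :=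
    (isOpen_lt continuous_const (by fun_prop : Continuous fun z : E => (inner ℝ z e : ℝ))).inter
      (isOpen_lt continuous_norm continuous_const)
  exact ⟨_, e, _, _, hs, ⟨hxe, by simp⟩, he,
    fun k => (smoothFamily_chart he hG hR (‖x‖ + 1)).iterate_reflQuot hs he k,
    fun k μ hμ z hz => reg_eq_hyperplaneReg hG hc he hz.1 hμ⟩

lemma contDiffAt_reg {x : E} (hx : x ≠ 0) (μ : ℂ) : ContDiffAt ℝ ∞ (fun z => reg G z μ) x := by
  obtain ⟨s, e, R, Θ, hs, hxs, he, hΘ, hreg⟩ := exists_smoothFamily_reg hG hc hx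
  obtain ⟨k, hk⟩ := exists_nat_halfPlane μ.re
  have hz : -1 < (μ + 2 * k).re := by
    simp
    linarith
  have h := ((hΘ k).contDiffOn_integral hs
    (locallyIntegrable_absPow_inner he hz)).contDiffAt (hs.mem_nhds hxs)
  refine ((contDiffAt_const (c := (-1 / 2) ^ k * (Complex.Gamma ((μ + 1) / 2 + k))⁻¹)).mul
    h).congr_of_eventuallyEq ?_
  filter_upwards [hs.mem_nhds hxs] with z hzs using hreg k μ hk z hzs

/-- Locally the Laplacian falls on the test function `Θ k` alone, so the result is again a
normalized integral of a power of a fixed linear form. -/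
lemma differentiable_laplacian_reg {x : E} (hx : x ≠ 0) :
    Differentiable ℂ fun μ => Laplacian.laplacian (fun z => reg G z μ) x := by
  obtain ⟨s, e, R, Θ, hs, hxs, he, hΘ, hreg⟩ := exists_smoothFamily_reg hG hc hx
  intro μ₀
  obtain ⟨k, hk⟩ := exists_nat_halfPlane μ₀.re
  have hL := (hΘ k).laplacian_integrand le_top hs
  have hd := (differentiableOn_normalizedIntegral he k (hL.contDiff_right hxs).continuous
    (hL.hasCompactSupport hxs)).differentiableAt ((isOpen_halfPlane _).mem_nhds hk)
  refine hd.congr_of_eventuallyEq ?_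
  filter_upwards [(isOpen_halfPlane _).mem_nhds hk] with μ hμ
  have hμ' : -1 - 2 * (k : ℝ) < μ.re := hμ
  have hz : -1 < (μ + 2 * k).re := by
    simp
    linarith
  have hloc := locallyIntegrable_absPow_inner he hz
  rw [← (hΘ k).laplacian_integral le_top hs hloc hxs, ← smul_eq_mul]
  have h2 : ContDiffAt ℝ 2 (fun z => ∫ y, absPow (μ + 2 * k) (inner ℝ e y) * Θ k z y) x := by
    exact_mod_cast (((hΘ k).of_le (k := 2) le_top).contDiffOn_integral hs hloc).contDiffAt
      (hs.mem_nhds hxs)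
  rw [← InnerProductSpace.laplacian_smul _ h2]
  refine (InnerProductSpace.laplacian_congr_nhds ?_).eq_of_nhds
  filter_upwards [hs.mem_nhds hxs] with z hzs using hreg k μ hμ z hzs

lemma laplacian_reg {x : E} (hx : x ≠ 0) (μ : ℂ) :
    Laplacian.laplacian (fun z => reg G z μ) x =
      2 * μ * reg (fun y => (‖y‖ : ℂ) ^ 2 * G y) x (μ - 2) := by
  set G₂ : E → ℂ := fun y => (‖y‖ : ℂ) ^ 2 * G y with hG₂
  have hG₂s : ContDiff ℝ ∞ G₂ := by
    have h1 : ContDiff ℝ ∞ fun y : E => ((‖y‖ ^ 2 : ℝ) : ℂ) :=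
      Complex.ofRealCLM.contDiff.comp (contDiff_norm_sq ℝ)
    simpa [hG₂] using h1.mul hG
  have hG₂c : HasCompactSupport G₂ := hc.mul_left
  have hr := isReg_reg hG₂s hG₂c hx
  -- For `Re μ > 2` the kernel is `C²` in `x`, so the Laplacian passes under the plain integral; `3`
  -- is merely a comfortable bound.
  refine congrFun (eq_of_eq_on_halfPlane (d := 3) (differentiable_laplacian_reg hG hc hx)
    ((by fun_prop : Differentiable ℂ fun μ : ℂ => 2 * μ).mul
      (hr.1.comp (f := fun μ : ℂ => μ - 2) (by fun_prop))) fun μ hμ => ?_) μ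
  obtain ⟨R, -, hR⟩ := exists_radius hc
  have hfam : SmoothFamily 2 ({0}ᶜ : Set E) R (fun z y => absPow μ (inner ℝ z y) * G y) := by
    refine ⟨fun z _ y => ?_, fun z _ y hy => by rw [hR y hy, mul_zero]⟩
    refine ContDiffAt.mul ?_ ?_
    · exact (contDiff_absPow (by linarith)).contDiffAt.comp (z, y)
        (contDiffAt_fst.inner ℝ contDiffAt_snd)
    · have h2 : ContDiff ℝ 2 G := mod_cast contDiff_infty.1 hG 2
      exact h2.contDiffAt.comp (z, y) contDiffAt_snd
  have hone : LocallyIntegrable (fun _ : E => (1 : ℂ)) := locallyIntegrable_const _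
  have hL := hfam.laplacian_integral le_rfl isOpen_compl_singleton hone hx
  have h2 : ContDiffAt ℝ 2 (fun z => ∫ y, 1 * (absPow μ (inner ℝ z y) * G y)) x := by
    exact_mod_cast (hfam.contDiffOn_integral isOpen_compl_singleton hone).contDiffAt
      (isOpen_compl_singleton.mem_nhds hx)
  have hev : (fun z => reg G z μ) =ᶠ[𝓝 x]
      ((Complex.Gamma ((μ + 1) / 2))⁻¹ • fun z => ∫ y, 1 * (absPow μ (inner ℝ z y) * G y)) := by
    filter_upwards [isOpen_compl_singleton.mem_nhds hx] with z hz
    simpa using (isReg_reg hG hc hz).2 μ (by linarith)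
  rw [(InnerProductSpace.laplacian_congr_nhds hev).eq_of_nhds,
    InnerProductSpace.laplacian_smul _ h2, hL]
  have hre : -1 < (μ - 2).re := by
    simp
    linarith
  simp only [Pi.mul_apply, Function.comp_apply]
  rw [hr.2 _ hre]
  simp only [laplacian_absPow_inner (show 2 < μ.re by linarith), one_mul, integral_const_mul,
    smul_eq_mul]
  have hne : (μ - 2 + 1) / 2 ≠ 0 := by
    intro h0
    have := congrArg Complex.re h0
    simp at this
    linarith
  have hμ1 : μ - 1 ≠ 0 := fun h => hne (by linear_combination h / 2)
  rw [show (μ + 1) / 2 = (μ - 2 + 1) / 2 + 1 by ring, Complex.Gamma_add_one _ hne, mul_inv,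
    show (μ - 2 + 1) / 2 = (μ - 1) / 2 by ring, inv_div]
  simp only [hG₂]
  field_simp

end Regularization

/-! ### Homogeneous extensions and test functions -/

section HomogeneousExtension

variable {n : ℕ}

lemma homExt_of_ne_zero (μ : ℂ) (f : Sph n → ℂ) {x : EuclideanSpace ℝ (Fin n)} (hx : x ≠ 0) :
    homExt μ f x = absPow μ ‖x‖ * f (toSph x hx) := by
  rw [homExt, dif_pos hx, absPow, abs_norm]

lemma homExt_coe (μ : ℂ) (f : Sph n → ℂ) (u : Sph n) : homExt μ f u = f u := by
  have hu : ‖(u : EuclideanSpace ℝ (Fin n))‖ = 1 := by simp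
  have hu0 : (u : EuclideanSpace ℝ (Fin n)) ≠ 0 := by
    rw [← norm_ne_zero_iff, hu]
    exact one_ne_zero
  rw [homExt_of_ne_zero μ f hu0]
  have : toSph (u : EuclideanSpace ℝ (Fin n)) hu0 = u := by
    ext1
    simp [toSph]
  simp [this, absPow]

lemma homExt_eq_mul (μ : ℂ) (f : Sph n → ℂ) (x : EuclideanSpace ℝ (Fin n)) :
    homExt μ f x = absPow μ ‖x‖ * homExt 0 f x := by
  by_cases hx : x = 0
  · simp [homExt, hx]
  · rw [homExt_of_ne_zero μ f hx, homExt_of_ne_zero 0 f hx]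
    simp [absPow]

lemma contDiffAt_absPow_norm (μ : ℂ) {x : EuclideanSpace ℝ (Fin n)} (hx : x ≠ 0) :
    ContDiffAt ℝ ∞ (fun y : EuclideanSpace ℝ (Fin n) => absPow μ ‖y‖) x := by
  have h1 : ContDiffAt ℝ ∞ (fun y : EuclideanSpace ℝ (Fin n) => Real.log ‖y‖) x :=
    (contDiffAt_norm ℝ hx).log (norm_ne_zero_iff.mpr hx)
  have h2 : ContDiffAt ℝ ∞ (fun y : EuclideanSpace ℝ (Fin n) => ((Real.log ‖y‖ : ℝ) : ℂ)) x :=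
    Complex.ofRealCLM.contDiff.contDiffAt.comp x h1
  refine ((h2.mul contDiffAt_const).cexp (x := x)).congr_of_eventuallyEq (f₁ := fun y => absPow μ ‖y‖)
    ?_ (f := fun y => Complex.exp (((Real.log ‖y‖ : ℝ) : ℂ) * μ))
  filter_upwards [isOpen_compl_singleton.mem_nhds hx] with y hy
  exact absPow_of_ne_zero μ (norm_ne_zero_iff.mpr hy)

lemma IsSmooth.contDiffAt_homExt {f : Sph n → ℂ} (hf : IsSmooth f) (μ : ℂ)
    {x : EuclideanSpace ℝ (Fin n)} (hx : x ≠ 0) : ContDiffAt ℝ ∞ (homExt μ f) x := by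
  have h := hf.contDiffAt (isOpen_compl_singleton.mem_nhds hx)
  exact ((contDiffAt_absPow_norm μ hx).mul h).congr_of_eventuallyEq
    (Eventually.of_forall fun y => homExt_eq_mul μ f y)

/-- A radial cutoff, supported in `1 < r < 3`. -/
def radialBump : ContDiffBump (2 : ℝ) := ⟨1 / 2, 1, by norm_num, by norm_num⟩

lemma radialBump_eq_zero {r : ℝ} (hr : r ≤ 1 ∨ 3 ≤ r) : radialBump r = 0 := by
  refine radialBump.zero_of_le_dist ?_
  rw [Real.dist_eq]
  rcases hr with hr | hr
  · exact (by linarith : (1 : ℝ) ≤ -(r - 2)).trans (neg_le_abs _)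
  · exact (by linarith : (1 : ℝ) ≤ r - 2).trans (le_abs_self _)

/-- The `-ν`-homogeneous extension of `f`, cut off radially. -/
def testFn (f : Sph n → ℂ) (ν : ℂ) (y : EuclideanSpace ℝ (Fin n)) : ℂ :=
  ((radialBump ‖y‖ : ℝ) : ℂ) * homExt (-ν) f y

lemma hasCompactSupport_testFn (f : Sph n → ℂ) (ν : ℂ) : HasCompactSupport (testFn f ν) := by
  refine HasCompactSupport.intro (isCompact_closedBall 0 3) fun y hy => ?_
  have : 3 < ‖y‖ := by simpa using hy
  simp [testFn, radialBump_eq_zero (Or.inr this.le)]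

lemma IsSmooth.contDiff_testFn {f : Sph n → ℂ} (hf : IsSmooth f) (ν : ℂ) :
    ContDiff ℝ ∞ (testFn f ν) := by
  rw [contDiff_iff_contDiffAt]
  intro x
  by_cases hx : x = 0
  · have : testFn f ν =ᶠ[𝓝 x] fun _ => 0 := by
      filter_upwards [(isOpen_lt continuous_norm continuous_const).mem_nhds
        (show x ∈ {y : EuclideanSpace ℝ (Fin n) | ‖y‖ < 1} by simp [hx])] with y hy
      have hy' : ‖y‖ < 1 := hy
      simp [testFn, radialBump_eq_zero (Or.inl hy'.le)]
    exact contDiffAt_const.congr_of_eventuallyEq this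
  · refine ContDiffAt.mul ?_ (hf.contDiffAt_homExt (-ν) hx)
    exact Complex.ofRealCLM.contDiff.contDiffAt.comp x
      (radialBump.contDiff.contDiffAt.comp x (contDiffAt_norm ℝ hx))

lemma normSq_mul_testFn (f : Sph n → ℂ) (ν : ℂ) (y : EuclideanSpace ℝ (Fin n)) :
    (‖y‖ : ℂ) ^ 2 * testFn f ν y = testFn f (ν - 2) y := by
  by_cases hy : y = 0
  · simp [testFn, homExt, hy]
  · rw [testFn, testFn, homExt_of_ne_zero _ _ hy, homExt_of_ne_zero _ _ hy,
      show -(ν - 2) = -ν + 2 by ring, absPow_add_two _ (norm_ne_zero_iff.mpr hy)]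
    ring

end HomogeneousExtension

/-! ### Polar coordinates -/

section Polar

variable {n : ℕ}

/-- The (unnormalized) surface measure. -/
abbrev surfaceMeasure (n : ℕ) : Measure (Sph n) :=
  (volume : Measure (EuclideanSpace ℝ (Fin n))).toSphere

/-- The measure `r^(n-1) dr` on `(0, ∞)`. -/
abbrev radialMeasure (n : ℕ) : Measure (Ioi (0 : ℝ)) :=
  Measure.volumeIoiPow (Module.finrank ℝ (EuclideanSpace ℝ (Fin n)) - 1)

/-- The radial factor `∫₀^∞ β(r) r^(w+n-1) dr` of the polar coordinates formula. -/
def radialFactor (n : ℕ) (w : ℂ) : ℂ :=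
  ∫ r : Ioi (0 : ℝ), ((radialBump r : ℝ) : ℂ) * absPow w r ∂(radialMeasure n)

lemma absPow_inner_mul_testFn (f : Sph n → ℂ) (μ ν : ℂ) (x : EuclideanSpace ℝ (Fin n))
    (z : ({0}ᶜ : Set (EuclideanSpace ℝ (Fin n)))) :
    absPow μ (inner ℝ x (z : EuclideanSpace ℝ (Fin n))) * testFn f ν z =
      f ((homeomorphUnitSphereProd _ z).1) *
        absPow μ (inner ℝ x ((homeomorphUnitSphereProd _ z).1 : EuclideanSpace ℝ (Fin n))) *
      (((radialBump (homeomorphUnitSphereProd _ z).2 : ℝ) : ℂ) *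
        absPow (μ - ν) (homeomorphUnitSphereProd _ z).2) := by
  have hz : (z : EuclideanSpace ℝ (Fin n)) ≠ 0 := z.2
  have hn : ‖(z : EuclideanSpace ℝ (Fin n))‖ ≠ 0 := norm_ne_zero_iff.mpr hz
  have h1 : (homeomorphUnitSphereProd _ z).1 = toSph (z : EuclideanSpace ℝ (Fin n)) hz := by
    ext1
    simp [toSph]
  have h2 : inner ℝ x (z : EuclideanSpace ℝ (Fin n)) =
      ‖(z : EuclideanSpace ℝ (Fin n))‖ *
        inner ℝ x (toSph (z : EuclideanSpace ℝ (Fin n)) hz : EuclideanSpace ℝ (Fin n)) := by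
    simp only [toSph, inner_smul_right]
    field_simp
  rw [homeomorphUnitSphereProd_apply_snd_coe, h1, h2, testFn, homExt_of_ne_zero _ _ hz, absPow_mul,
    sub_eq_add_neg, absPow_add _ _ hn]
  ring

lemma polar_integral (f : Sph n → ℂ) (μ ν : ℂ) (x : EuclideanSpace ℝ (Fin n)) :
    ∫ y, absPow μ (inner ℝ x y) * testFn f ν y =
      (∫ v, f v * absPow μ (inner ℝ x (v : EuclideanSpace ℝ (Fin n))) ∂(surfaceMeasure n)) *
        radialFactor n (μ - ν) := by
  calc ∫ y, absPow μ (inner ℝ x y) * testFn f ν y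
      = ∫ z : ({0}ᶜ : Set (EuclideanSpace ℝ (Fin n))),
        absPow μ (inner ℝ x (z : EuclideanSpace ℝ (Fin n))) * testFn f ν z
          ∂((volume : Measure (EuclideanSpace ℝ (Fin n))).comap (↑)) := by
        -- In the zero space the volume charges the origin, so the origin cannot be discarded; there
        -- both sides vanish with the test function.
        by_cases hE : Nontrivial (EuclideanSpace ℝ (Fin n))
        · rw [integral_subtype_comap (measurableSet_singleton _).compl fun y =>
            absPow μ (inner ℝ x y) * testFn f ν y, restrict_compl_singleton]
        · have hz : ∀ y, testFn f ν y = 0 := fun y => by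
            have : y = 0 := by
              by_contra hy
              exact hE ⟨y, 0, hy⟩
            simp [testFn, homExt, this]
          simp [hz]
    _ = ∫ z, (f z.1 * absPow μ (inner ℝ x (z.1 : EuclideanSpace ℝ (Fin n)))) *
        (((radialBump z.2 : ℝ) : ℂ) * absPow (μ - ν) z.2)
          ∂((surfaceMeasure n).prod (radialMeasure n)) := by
        rw [← (volume : Measure (EuclideanSpace ℝ (Fin n))).measurePreserving_homeomorphUnitSphereProd.integral_comp
          (Homeomorph.measurableEmbedding _)]
        congr 1 with z
        exact absPow_inner_mul_testFn f μ ν x z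
    _ = _ := integral_prod_mul (L := ℂ) (μ := surfaceMeasure n) (ν := radialMeasure n)
        (fun v : Sph n => f v * absPow μ (inner ℝ x (v : EuclideanSpace ℝ (Fin n))))
        (fun r : Ioi (0 : ℝ) => ((radialBump r : ℝ) : ℂ) * absPow (μ - ν) r)

lemma volumeIoiPow_integral (m : ℕ) (g : ℝ → ℂ) :
    ∫ r : Ioi (0 : ℝ), g r ∂(Measure.volumeIoiPow m) = ∫ r in Ioi (0 : ℝ), r ^ m • g r := by
  simp only [Measure.volumeIoiPow, ENNReal.ofReal]
  rw [integral_withDensity_eq_integral_smul,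
    integral_subtype_comap measurableSet_Ioi fun a ↦ Real.toNNReal (a ^ m) • g a,
    setIntegral_congr_fun measurableSet_Ioi fun x hx ↦ ?_]
  · rw [NNReal.smul_def, Real.coe_toNNReal _ (pow_nonneg hx.out.le _)]
  · exact (measurable_subtype_coe.pow_const _).real_toNNReal

lemma radialFactor_eq_mellin (n : ℕ) (w : ℂ) : radialFactor n w =
    mellin (fun r : ℝ =>
      ((r ^ (Module.finrank ℝ (EuclideanSpace ℝ (Fin n)) - 1) * radialBump r : ℝ) : ℂ)) (w + 1) := by
  rw [radialFactor, mellin, volumeIoiPow_integral _ fun r => ((radialBump r : ℝ) : ℂ) * absPow w r]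
  refine setIntegral_congr_fun measurableSet_Ioi fun r hr => ?_
  have hr' : (0 : ℝ) < r := hr
  simp only [absPow, abs_of_pos hr', add_sub_cancel_right, smul_eq_mul, Complex.real_smul]
  push_cast
  ring

/-- A Mellin transform of a function vanishing near `0` and near infinity is entire. -/
lemma differentiable_radialFactor (n : ℕ) : Differentiable ℂ (radialFactor n) := by
  have h : radialFactor n = mellin (fun r : ℝ => ((r ^
      (Module.finrank ℝ (EuclideanSpace ℝ (Fin n)) - 1) * radialBump r : ℝ) : ℂ)) ∘ (· + 1) :=
    funext fun w => radialFactor_eq_mellin n w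
  rw [h]
  intro w
  refine DifferentiableAt.comp w (mellin_differentiableAt_of_isBigO_rpow (a := w.re + 2) (b := w.re)
    ?_ ?_ (by simp) ?_ (by simp)) (by fun_prop)
  · have : Continuous fun r : ℝ => ((r ^ (Module.finrank ℝ (EuclideanSpace ℝ (Fin n)) - 1) *
        radialBump r : ℝ) : ℂ) :=
      Complex.continuous_ofReal.comp ((continuous_pow _).mul radialBump.continuous)
    exact this.locallyIntegrable.locallyIntegrableOn _
  · refine (Asymptotics.isBigO_zero _ _).congr' ?_ EventuallyEq.rfl
    filter_upwards [eventually_ge_atTop 3] with r hr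
    simp [radialBump_eq_zero (Or.inr hr)]
  · refine (Asymptotics.isBigO_zero _ _).congr' ?_ EventuallyEq.rfl
    filter_upwards [nhdsWithin_le_nhds (Iic_mem_nhds (one_pos : (0 : ℝ) < 1))] with r hr
    simp [radialBump_eq_zero (Or.inl hr)]

lemma radialFactor_zero_ne_zero (n : ℕ) : radialFactor n 0 ≠ 0 := by
  rw [radialFactor_eq_mellin, mellin]
  simp only [zero_add, sub_self, Complex.cpow_zero, one_smul]
  rw [integral_complex_ofReal, Complex.ofReal_ne_zero]
  set m := Module.finrank ℝ (EuclideanSpace ℝ (Fin n)) - 1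
  have hcont : Continuous fun r : ℝ => r ^ m * radialBump r :=
    (continuous_pow _).mul radialBump.continuous
  have hcs : HasCompactSupport fun r : ℝ => r ^ m * radialBump r :=
    radialBump.hasCompactSupport.mul_left
  refine ne_of_gt ((setIntegral_pos_iff_support_of_nonneg_ae ?_
    (hcont.integrable_of_hasCompactSupport hcs).integrableOn).2 ?_)
  · filter_upwards [ae_restrict_mem measurableSet_Ioi] with r hr
    exact mul_nonneg (pow_nonneg (le_of_lt hr) _) radialBump.nonneg
  · refine lt_of_lt_of_le ?_ (measure_mono (?_ : Ioo (3 / 2 : ℝ) (5 / 2) ⊆ _))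
    · simp
      norm_num
    · rintro r ⟨h1, h2⟩
      have hr : 0 < r := by linarith
      have hone : radialBump r = 1 := radialBump.one_of_mem_closedBall (by
        rw [Metric.mem_closedBall, Real.dist_eq, abs_le]
        constructor <;> simp only [radialBump] <;> linarith)
      refine ⟨?_, hr⟩
      rw [Function.mem_support, hone]
      positivity

/-- By Fubini, integrability on `ℝⁿ` passes to almost every sphere. Since `radialFactor n 0` is
nonzero, some such radius has a nonzero radial weight, which can be divided out. -/
lemma IsSmooth.integrable_surface {f : Sph n → ℂ} (hf : IsSmooth f) {μ : ℂ} (hμ : -1 < μ.re)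
    (u : Sph n) : Integrable (fun v : Sph n => f v *
      absPow μ (inner ℝ (u : EuclideanSpace ℝ (Fin n)) (v : EuclideanSpace ℝ (Fin n))))
      (surfaceMeasure n) := by
  have hint : Integrable fun y : EuclideanSpace ℝ (Fin n) =>
      absPow μ (inner ℝ (u : EuclideanSpace ℝ (Fin n)) y) * testFn f μ y := by
    have := (locallyIntegrable_absPow_inner (e := (u : EuclideanSpace ℝ (Fin n))) (by simp)
      hμ).integrable_smul_right_of_hasCompactSupport (hf.contDiff_testFn μ).continuous
      (hasCompactSupport_testFn f μ)
    simpa using this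
  have h1 := (integrableOn_iff_comap_subtypeVal (measurableSet_singleton
    (0 : EuclideanSpace ℝ (Fin n))).compl).1 hint.integrableOn
  have h2 : Integrable (fun z : Sph n × Ioi (0 : ℝ) => (f z.1 *
      absPow μ (inner ℝ (u : EuclideanSpace ℝ (Fin n)) (z.1 : EuclideanSpace ℝ (Fin n)))) *
        (((radialBump z.2 : ℝ) : ℂ) * absPow (μ - μ) z.2))
      ((surfaceMeasure n).prod (radialMeasure n)) := by
    rw [← (volume : Measure (EuclideanSpace ℝ (Fin n))).measurePreserving_homeomorphUnitSphereProd.integrable_comp_emb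
      (Homeomorph.measurableEmbedding _)]
    refine h1.congr (Eventually.of_forall fun z => ?_)
    exact absPow_inner_mul_testFn f μ μ u z
  have h3 := h2.prod_left_ae
  have h4 : ∃ r : Ioi (0 : ℝ), ((radialBump r : ℝ) : ℂ) * absPow (μ - μ) r ≠ 0 ∧
      Integrable (fun v : Sph n => (f v * absPow μ
        (inner ℝ (u : EuclideanSpace ℝ (Fin n)) (v : EuclideanSpace ℝ (Fin n)))) *
        (((radialBump r : ℝ) : ℂ) * absPow (μ - μ) r)) (surfaceMeasure n) := by
    by_contra! hcon
    refine radialFactor_zero_ne_zero n ?_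
    rw [radialFactor]
    refine integral_eq_zero_of_ae ?_
    filter_upwards [h3] with r hr
    by_contra hne
    rw [sub_self] at hcon
    exact hcon r hne (by simpa using hr)
  obtain ⟨r, hr, hri⟩ := h4
  refine (hri.mul_const (((radialBump r : ℝ) : ℂ) * absPow (μ - μ) r)⁻¹).congr
    (Eventually.of_forall fun v => ?_)
  exact mul_inv_cancel_right₀ hr _

end Polar

/-! ### The regularized integral over the sphere -/

section SphereRegularization

variable {n : ℕ}

/-- The entire continuation of `μ ↦ Γ((μ+1)/2)⁻¹ ∫ f(v) |⟪x, v⟫|^μ dσ(v)`, for `x ≠ 0`. -/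
def sphereReg (f : Sph n → ℂ) (x : EuclideanSpace ℝ (Fin n)) (μ : ℂ) : ℂ :=
  (radialFactor n 0)⁻¹ * reg (testFn f μ) x μ

variable {f : Sph n → ℂ} (hf : IsSmooth f)

include hf

lemma IsSmooth.reg_testFn {x : EuclideanSpace ℝ (Fin n)} (hx : x ≠ 0) {μ : ℂ} (hμ : -1 < μ.re)
    (ν : ℂ) : reg (testFn f ν) x μ = (Complex.Gamma ((μ + 1) / 2))⁻¹ *
      ((∫ v, f v * absPow μ (inner ℝ x (v : EuclideanSpace ℝ (Fin n))) ∂(surfaceMeasure n)) *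
        radialFactor n (μ - ν)) := by
  rw [(isReg_reg (hf.contDiff_testFn ν) (hasCompactSupport_testFn f ν) hx).2 μ hμ, polar_integral]

lemma IsSmooth.differentiable_reg_testFn {x : EuclideanSpace ℝ (Fin n)} (hx : x ≠ 0) (ν : ℂ) :
    Differentiable ℂ (reg (testFn f ν) x) :=
  (isReg_reg (hf.contDiff_testFn ν) (hasCompactSupport_testFn f ν) hx).1

lemma IsSmooth.sphereReg_eq_integral {x : EuclideanSpace ℝ (Fin n)} (hx : x ≠ 0) {μ : ℂ}
    (hμ : -1 < μ.re) : sphereReg f x μ = (Complex.Gamma ((μ + 1) / 2))⁻¹ *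
      ∫ v, f v * absPow μ (inner ℝ x (v : EuclideanSpace ℝ (Fin n))) ∂(surfaceMeasure n) := by
  have := radialFactor_zero_ne_zero n
  rw [sphereReg, hf.reg_testFn hx hμ, sub_self]
  field_simp

/-- In `sphereReg` the test function moves with `μ`, so holomorphy is not visible. Freezing `ν`
repairs this: the cross products of two frozen versions agree for `Re μ > -1`, hence everywhere. -/
lemma IsSmooth.sphereReg_mul_radialFactor {x : EuclideanSpace ℝ (Fin n)} (hx : x ≠ 0) (μ ν : ℂ) :
    sphereReg f x μ * radialFactor n (μ - ν) = reg (testFn f ν) x μ := by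
  have hd : ∀ ν : ℂ, Differentiable ℂ fun μ => radialFactor n (μ - ν) := fun ν =>
    (differentiable_radialFactor n).comp (f := fun μ : ℂ => μ - ν) (by fun_prop)
  have key : ∀ ν' : ℂ, (fun z => reg (testFn f ν') x z * radialFactor n (z - ν)) =
      fun z => reg (testFn f ν) x z * radialFactor n (z - ν') := fun ν' => by
    refine eq_of_eq_on_halfPlane (d := -1) ((hf.differentiable_reg_testFn hx ν').mul (hd ν))
      ((hf.differentiable_reg_testFn hx ν).mul (hd ν')) fun z hz => ?_
    rw [hf.reg_testFn hx hz, hf.reg_testFn hx hz]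
    ring
  have h := congrFun (key μ) μ
  have h0 := radialFactor_zero_ne_zero n
  simp only [sub_self] at h
  rw [sphereReg, mul_assoc, h]
  field_simp

lemma IsSmooth.differentiable_sphereReg {x : EuclideanSpace ℝ (Fin n)} (hx : x ≠ 0) :
    Differentiable ℂ (sphereReg f x) := by
  intro ν
  have hc : Differentiable ℂ fun μ => radialFactor n (μ - ν) :=
    (differentiable_radialFactor n).comp (f := fun μ : ℂ => μ - ν) (by fun_prop)
  have hν : radialFactor n (ν - ν) ≠ 0 := by
    rw [sub_self]
    exact radialFactor_zero_ne_zero n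
  refine (((hf.differentiable_reg_testFn hx ν) ν).div (hc ν) hν).congr_of_eventuallyEq ?_
  filter_upwards [hc.continuous.continuousAt.eventually_ne hν] with μ hμ
  rw [Pi.div_apply, ← hf.sphereReg_mul_radialFactor hx μ ν, mul_div_cancel_right₀ _ hμ]

/-- Homogeneity of the kernel, continued in `μ`. The case `c = ‖x‖` identifies the homogeneous
extension, and `c = -1` gives evenness. -/
lemma IsSmooth.sphereReg_smul {x : EuclideanSpace ℝ (Fin n)} (hx : x ≠ 0) {c : ℝ} (hc : c ≠ 0)
    (μ : ℂ) : sphereReg f (c • x) μ = absPow μ c * sphereReg f x μ := by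
  have hcx : c • x ≠ 0 := smul_ne_zero hc hx
  have hd : Differentiable ℂ fun μ => absPow μ c := fun μ =>
    (hasDerivAt_absPow_exponent μ hc).differentiableAt
  refine congrFun (eq_of_eq_on_halfPlane (d := -1) (hf.differentiable_sphereReg hcx)
    (hd.mul (hf.differentiable_sphereReg hx)) fun z hz => ?_) μ
  have hI : ∫ v, f v * absPow z (inner ℝ (c • x) (v : EuclideanSpace ℝ (Fin n)))
        ∂(surfaceMeasure n) = absPow z c *
      ∫ v, f v * absPow z (inner ℝ x (v : EuclideanSpace ℝ (Fin n))) ∂(surfaceMeasure n) := by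
    rw [← integral_const_mul]
    congr 1 with v
    rw [real_inner_smul_left, absPow_mul]
    ring
  rw [Pi.mul_apply, hf.sphereReg_eq_integral hcx hz, hf.sphereReg_eq_integral hx hz, hI]
  ring

lemma IsSmooth.homExt_sphereReg (μ : ℂ) {x : EuclideanSpace ℝ (Fin n)} (hx : x ≠ 0) :
    homExt μ (fun u : Sph n => sphereReg f u μ) x = sphereReg f x μ := by
  have hn : ‖x‖ ≠ 0 := norm_ne_zero_iff.mpr hx
  have hu : (toSph x hx : EuclideanSpace ℝ (Fin n)) ≠ 0 := by
    simp [toSph, hx]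
  rw [homExt_of_ne_zero _ _ hx, ← hf.sphereReg_smul hu hn]
  simp [toSph, smul_smul, mul_inv_cancel₀ hn]

lemma IsSmooth.contDiffAt_sphereReg (μ : ℂ) {x : EuclideanSpace ℝ (Fin n)} (hx : x ≠ 0) :
    ContDiffAt ℝ ∞ (fun z => sphereReg f z μ) x :=
  contDiffAt_const.mul
    (contDiffAt_reg (hf.contDiff_testFn μ) (hasCompactSupport_testFn f μ) hx μ)

lemma IsSmooth.laplacian_sphereReg (μ : ℂ) {x : EuclideanSpace ℝ (Fin n)} (hx : x ≠ 0) :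
    Laplacian.laplacian (fun z => sphereReg f z μ) x = 2 * μ * sphereReg f x (μ - 2) := by
  have h2 : ContDiffAt ℝ 2 (fun z => reg (testFn f μ) z μ) x :=
    mod_cast contDiffAt_infty.1
      (contDiffAt_reg (hf.contDiff_testFn μ) (hasCompactSupport_testFn f μ) hx μ) 2
  have h := InnerProductSpace.laplacian_smul (radialFactor n 0)⁻¹ h2
  rw [laplacian_reg (hf.contDiff_testFn μ) (hasCompactSupport_testFn f μ) hx] at h
  simp only [normSq_mul_testFn] at h
  refine Eq.trans h ?_
  rw [sphereReg, smul_eq_mul]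
  ring

end SphereRegularization

/-! ### The cosine transform and its Laplacian -/

section Continuation

variable {n : ℕ}

lemma countable_poles : poles.Countable := by
  have : poles = range fun k : ℕ => 2 * (k : ℂ) := by
    ext z
    simp [poles, eq_comm]
  rw [this]
  exact countable_range _

/-- The meromorphic continuation in `μ` of the normalized cosine transform. -/
def cosineContinuation (f : Sph n → ℂ) (μ : ℂ) (u : Sph n) : ℂ :=
  ((Real.sqrt Real.pi : ℝ) : ℂ) * Complex.Gamma (-μ / 2) / Complex.Gamma ((n : ℂ) / 2) *
    ((((surfaceMeasure n) univ)⁻¹).toReal : ℂ) * sphereReg f (u : EuclideanSpace ℝ (Fin n)) μ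

lemma coe_ne_zero (u : Sph n) : (u : EuclideanSpace ℝ (Fin n)) ≠ 0 := by
  rw [← norm_ne_zero_iff]
  simp

lemma analyticAt_Gamma {μ : ℂ} (hμ : μ ∉ poles) :
    AnalyticAt ℂ (fun μ : ℂ => Complex.Gamma (-μ / 2)) μ := by
  have hd : Differentiable ℂ fun μ : ℂ => (Complex.Gamma (-μ / 2))⁻¹ :=
    Complex.differentiable_one_div_Gamma.comp (f := fun μ : ℂ => -μ / 2) (by fun_prop)
  have hne : Complex.Gamma (-μ / 2) ≠ 0 := Complex.Gamma_ne_zero fun m hm =>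
    hμ ⟨m, by linear_combination (-2 : ℂ) * hm⟩
  have h := (hd.analyticAt μ).inv (inv_ne_zero hne)
  refine h.congr (Eventually.of_forall fun z => ?_)
  simp

lemma meromorphic_Gamma : Meromorphic (fun μ : ℂ => Complex.Gamma (-μ / 2)) := by
  have hd : Differentiable ℂ fun μ : ℂ => (Complex.Gamma (-μ / 2))⁻¹ :=
    Complex.differentiable_one_div_Gamma.comp (f := fun μ : ℂ => -μ / 2) (by fun_prop)
  intro μ
  have h := (hd.analyticAt μ).meromorphicAt.inv
  refine h.congr (Eventually.of_forall fun z => ?_)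
  simp

lemma cosineIntegral_eq (μ : ℂ) (f : Sph n → ℂ) (u : Sph n) : cosineIntegral μ f u =
    gam n μ * ((((surfaceMeasure n) univ)⁻¹).toReal *
      ∫ v, f v * absPow μ (inner ℝ (u : EuclideanSpace ℝ (Fin n)) (v : EuclideanSpace ℝ (Fin n)))
        ∂(surfaceMeasure n)) := by
  rw [cosineIntegral, sphMeasure]
  simp only [integral_smul_measure, Complex.real_smul]
  rfl

variable {f : Sph n → ℂ}

lemma IsSmooth.isContinuation (hf : IsSmooth f) (u : Sph n) :
    IsContinuation f u (fun μ => cosineContinuation f μ u) := by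
  have hd := hf.differentiable_sphereReg (coe_ne_zero u)
  refine ⟨fun μ => ?_, fun μ hμ => ?_, fun μ hμ _ => ?_⟩
  · have h1 := meromorphic_Gamma μ
    have h2 := (hd.analyticAt μ).meromorphicAt
    exact ((((MeromorphicAt.const _ μ).mul h1).div (MeromorphicAt.const _ μ)).mul
      (MeromorphicAt.const _ μ)).mul h2
  · simp only [cosineContinuation, div_eq_mul_inv]
    exact (((analyticAt_const.mul (analyticAt_Gamma hμ)).mul analyticAt_const).mul
      analyticAt_const).mul (hd.analyticAt μ)
  · simp only [cosineContinuation]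
    rw [cosineIntegral_eq, hf.sphereReg_eq_integral (coe_ne_zero u) hμ, gam]
    rw [div_eq_mul_inv _ (Complex.Gamma (n / 2) * _), mul_inv]
    ring

/-- The complement of a countable set in the plane is connected, and the disc of radius `1` about
`1` avoids the poles and lies in the domain of convergence. -/
lemma IsContinuation.eqOn {u : Sph n} {F H : ℂ → ℂ} (hF : IsContinuation f u F)
    (hH : IsContinuation f u H) : EqOn F H polesᶜ := by
  have hpre : IsPreconnected polesᶜ :=
    (countable_poles.isConnected_compl_of_one_lt_rank (by simp)).isPreconnected
  have hnp : ∀ z : ℂ, ‖z - 1‖ < 1 → z ∉ poles ∧ -1 < z.re := by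
    intro z hz
    have h1 := (Complex.abs_re_le_norm (z - 1)).trans_lt hz
    rw [Complex.sub_re, Complex.one_re, abs_lt] at h1
    refine ⟨?_, by linarith⟩
    rintro ⟨k, rfl⟩
    have h3 : ((2 : ℂ) * (k : ℂ)).re = 2 * (k : ℝ) := by simp
    rw [h3] at h1
    have h4 : (0 : ℝ) < k := by linarith
    have h5 : (k : ℝ) < 1 := by linarith
    have h6 : 0 < k := by exact_mod_cast h4
    have h7 : k < 1 := by exact_mod_cast h5
    omega
  refine hF.2.1.eqOn_of_preconnected_of_eventuallyEq hH.2.1 hpre (z₀ := 1)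
    (hnp 1 (by simp)).1 ?_
  filter_upwards [Metric.ball_mem_nhds (1 : ℂ) one_pos] with z hz
  have h := hnp z (by simpa [dist_eq_norm] using hz)
  rw [hF.2.2 z h.2 h.1, hH.2.2 z h.2 h.1]

lemma IsSmooth.isContinuation_cosineTransform (hf : IsSmooth f) (u : Sph n) :
    IsContinuation f u (fun μ => cosineTransform μ f u) :=
  Classical.epsilon_spec ⟨_, hf.isContinuation u⟩

lemma IsSmooth.cosineTransform_eq (hf : IsSmooth f) {μ : ℂ} (hμ : μ ∉ poles) :
    cosineTransform μ f = cosineContinuation f μ :=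
  funext fun u => (hf.isContinuation_cosineTransform u).eqOn (hf.isContinuation u) hμ

lemma IsSmooth.homExt_cosineContinuation (hf : IsSmooth f) (μ : ℂ)
    {x : EuclideanSpace ℝ (Fin n)} (hx : x ≠ 0) : homExt μ (cosineContinuation f μ) x =
      ((Real.sqrt Real.pi : ℝ) : ℂ) * Complex.Gamma (-μ / 2) / Complex.Gamma ((n : ℂ) / 2) *
    ((((surfaceMeasure n) univ)⁻¹).toReal : ℂ) * sphereReg f x μ := by
  rw [← hf.homExt_sphereReg μ hx, homExt_of_ne_zero _ _ hx, homExt_of_ne_zero _ _ hx,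
    cosineContinuation]
  ring

lemma IsSmooth.contDiffAt_homExt_cosineContinuation (hf : IsSmooth f) (μ : ℂ)
    {x : EuclideanSpace ℝ (Fin n)} (hx : x ≠ 0) :
    ContDiffAt ℝ ∞ (homExt μ (cosineContinuation f μ)) x := by
  refine (contDiffAt_const.mul (hf.contDiffAt_sphereReg μ hx)).congr_of_eventuallyEq
    (f := fun z => ((Real.sqrt Real.pi : ℝ) : ℂ) * Complex.Gamma (-μ / 2) /
      Complex.Gamma ((n : ℂ) / 2) * ((((surfaceMeasure n) univ)⁻¹).toReal : ℂ) * sphereReg f z μ) ?_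
  filter_upwards [isOpen_compl_singleton.mem_nhds hx] with z hz
  exact hf.homExt_cosineContinuation μ hz

lemma IsSmooth.isSmoothEven_cosineContinuation (hf : IsSmooth f) (μ : ℂ) :
    IsSmoothEven (cosineContinuation f μ) := by
  refine ⟨fun x hx => ContDiffAt.contDiffWithinAt ?_, fun u => ?_⟩
  · have hx' : x ≠ 0 := hx
    refine ((contDiffAt_absPow_norm (-μ) hx').mul
      (hf.contDiffAt_homExt_cosineContinuation μ hx')).congr_of_eventuallyEq ?_
    filter_upwards [isOpen_compl_singleton.mem_nhds hx'] with z hz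
    have hz' : ‖z‖ ≠ 0 := norm_ne_zero_iff.mpr hz
    rw [homExt_eq_mul μ, ← mul_assoc, ← absPow_add _ _ hz', neg_add_cancel]
    simp [absPow]
  · have h := hf.sphereReg_smul (coe_ne_zero u) (neg_ne_zero.mpr one_ne_zero) μ
    have h1 : absPow μ (-1) = 1 := by simp [absPow]
    rw [h1, one_mul, neg_smul, one_smul] at h
    rw [cosineContinuation, cosineContinuation, ← h]
    rfl

/-- The factor `2μ` of `laplacian_sphereReg` is `-4 · (-μ/2)`, and `Γ(-μ/2 + 1) = (-μ/2) Γ(-μ/2)`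
for `μ ≠ 0`. -/
lemma IsSmooth.laplacian_homExt_cosineContinuation (hf : IsSmooth f) {μ : ℂ} (hμ : μ ≠ 0)
    {x : EuclideanSpace ℝ (Fin n)} (hx : x ≠ 0) :
    Laplacian.laplacian (homExt μ (cosineContinuation f μ)) x =
      -4 * homExt (μ - 2) (cosineContinuation f (μ - 2)) x := by
  set C : ℂ := ((Real.sqrt Real.pi : ℝ) : ℂ) * Complex.Gamma (-μ / 2) /
      Complex.Gamma ((n : ℂ) / 2) * ((((surfaceMeasure n) univ)⁻¹).toReal : ℂ) with hC
  have hev : homExt μ (cosineContinuation f μ) =ᶠ[𝓝 x] C • fun z => sphereReg f z μ := by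
    filter_upwards [isOpen_compl_singleton.mem_nhds hx] with z hz
    exact hf.homExt_cosineContinuation μ hz
  have h2 : ContDiffAt ℝ 2 (fun z => sphereReg f z μ) x :=
    mod_cast contDiffAt_infty.1 (hf.contDiffAt_sphereReg μ hx) 2
  rw [(InnerProductSpace.laplacian_congr_nhds hev).eq_of_nhds,
    InnerProductSpace.laplacian_smul _ h2, hf.laplacian_sphereReg μ hx,
    hf.homExt_cosineContinuation _ hx, hC, smul_eq_mul, show -(μ - 2) / 2 = -μ / 2 + 1 by ring,
    Complex.Gamma_add_one _ (by simpa using hμ)]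
  ring

lemma notMem_poles_of_add_notMem {lam : ℂ} {l : ℕ} (h : lam + 2 * (l : ℂ) ∉ poles) : lam ∉ poles := by
  rintro ⟨k, rfl⟩
  exact h ⟨k + l, by push_cast; ring⟩

lemma IsSmooth.iterate_laplacian_homExt (hf : IsSmooth f) (l : ℕ) :
    ∀ lam : ℂ, lam + 2 * (l : ℂ) ∉ poles → ∀ x : EuclideanSpace ℝ (Fin n), x ≠ 0 →
      ((Laplacian.laplacian : (EuclideanSpace ℝ (Fin n) → ℂ) → EuclideanSpace ℝ (Fin n) → ℂ)^[l]
        (homExt (lam + 2 * (l : ℂ)) (cosineContinuation f (lam + 2 * (l : ℂ))))) x =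
      (-4) ^ l * homExt lam (cosineContinuation f lam) x := by
  induction l with
  | zero => simp
  | succ l ih =>
    intro lam hlam x hx
    have e1 : lam + 2 * ((l + 1 : ℕ) : ℂ) = lam + 2 + 2 * (l : ℂ) := by push_cast; ring
    rw [e1] at hlam ⊢
    rw [Function.iterate_succ_apply']
    -- The inner `l` Laplacians lead down to exponent `lam + 2`, whence the induction over all
    -- `lam`; the outer one needs the equality on a neighbourhood of `x`.
    have hev : ((Laplacian.laplacian : (EuclideanSpace ℝ (Fin n) → ℂ) →
        EuclideanSpace ℝ (Fin n) → ℂ)^[l] (homExt (lam + 2 + 2 * (l : ℂ))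
          (cosineContinuation f (lam + 2 + 2 * (l : ℂ))))) =ᶠ[𝓝 x]
        ((-4 : ℂ) ^ l) • homExt (lam + 2) (cosineContinuation f (lam + 2)) := by
      filter_upwards [isOpen_compl_singleton.mem_nhds hx] with z hz using ih _ hlam z hz
    have h2 : ContDiffAt ℝ 2 (homExt (lam + 2) (cosineContinuation f (lam + 2))) x :=
      mod_cast contDiffAt_infty.1 (hf.contDiffAt_homExt_cosineContinuation _ hx) 2
    have hne : lam + 2 ≠ 0 := fun h => notMem_poles_of_add_notMem hlam ⟨0, by simpa using h⟩
    rw [(InnerProductSpace.laplacian_congr_nhds hev).eq_of_nhds,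
      InnerProductSpace.laplacian_smul _ h2, hf.laplacian_homExt_cosineContinuation hne hx,
      add_sub_cancel_right, smul_eq_mul]
    ring

end Continuation

end CosineTransform

end

theorem proposition2p2 (n : ℕ) (hn : 3 ≤ n) (f : CosineTransform.Sph n → ℂ)
    (hf : CosineTransform.IsSmoothEven f) :
    -- the defining integral converges absolutely for `Re μ > -1`
    (∀ (μ : ℂ) (u : CosineTransform.Sph n), -1 < μ.re →
      MeasureTheory.Integrable (CosineTransform.cosineIntegrand μ f u)
        (CosineTransform.sphMeasure n)) ∧
    -- the continuation that defines the cosine transform exists, with smooth even values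
    (∀ u : CosineTransform.Sph n,
      CosineTransform.IsContinuation f u (fun μ => CosineTransform.cosineTransform μ f u)) ∧
    (∀ μ : ℂ, μ ∉ CosineTransform.poles →
      CosineTransform.IsSmoothEven (CosineTransform.cosineTransform μ f)) ∧
    -- the identity
    ∀ (l : ℕ) (lam : ℂ), lam + 2 * (l : ℂ) ∉ CosineTransform.poles →
      CosineTransform.weightedLaplacian lam l
          (CosineTransform.cosineTransform (lam + 2 * (l : ℂ)) f) =
        CosineTransform.cosineTransform lam f := by
  have hs := hf.1
  refine ⟨fun μ u hμ => ?_, hs.isContinuation_cosineTransform, fun μ hμ => ?_, fun l lam h => ?_⟩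
  -- Nontriviality makes the total surface mass nonzero, so the normalizing constant is finite.
  · have : Nontrivial (EuclideanSpace ℝ (Fin n)) :=
      ⟨u, 0, CosineTransform.coe_ne_zero u⟩
    refine (hs.integrable_surface hμ u).smul_measure (ENNReal.inv_ne_top.mpr ?_)
    exact (MeasureTheory.Measure.measure_univ_ne_zero).mpr
      (MeasureTheory.Measure.toSphere_ne_zero _)
  · rw [hs.cosineTransform_eq hμ]
    exact hs.isSmoothEven_cosineContinuation μ
  · rw [hs.cosineTransform_eq h, hs.cosineTransform_eq (CosineTransform.notMem_poles_of_add_notMem h)]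
    ext u
    rw [CosineTransform.weightedLaplacian,
      hs.iterate_laplacian_homExt l lam h _ (CosineTransform.coe_ne_zero u), ← mul_assoc, ← mul_pow,
      CosineTransform.homExt_coe]
    norm_num
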